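/- Let $T$ be a finite tree whose vertex set $V$, with $\nu=|V|\ge 1$ elements, is partitioned into negative and positive vertices, $V=V^-\sqcup V^+$; for $U\subseteq V$ write $U^\pm=U\cap V^\pm$. A \emph{signed spine} on $T$ is a directed tree $S$ whose nodes are labeled by the (non-empty) parts of a partition of $V$ such that, at each node with label $U$, the source label sets of the different incoming arcs are subsets of distinct connected components of $T\setminus U^-$, and the sink label sets of the different outgoing arcs are subsets of distinct connected components of $T\setminus U^+$. Here the source (resp. sink) label set of an arc $r$ is the union of the labels in the connected component of $S\setminus\{r\}$ containing the source (resp. sink) of $r$. Signed spines are ordered by arc contraction ($S\le S'$ if $S$ is obtained from $S'$ by contracting arcs). Write $u\le_S v$ if there is a directed path, possibly of length zero, in $S$ from the node whose label contains $u$ to the node whose label contains $v$. In the hyperplane $\mathbb{H}=\{x\in\mathbb{R}^V \mid \sum_{v\in V}x_v=\binom{\nu+1}{2}\}$ let $$C(S)=\{x\in\mathbb{H}\mid x_u\le x_v \text{ for all } u,v\in V \text{ with } u\le_S v\}.$$ \textbf{Theorem.} (1) The collection $\mathcal{F}(T)=\{C(S)\mid S \text{ a signed spine on } T\}$ is a complete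 simplicial fan on $\mathbb{H}$ with apex $\tfrac{\nu+1}{2}(1,\dots,1)$: it is a finite collection of simplicial cones with this apex, it contains all faces of its cones, any two of its cones intersect in a common face of both, and its union is $\mathbb{H}$. (2) $\mathcal{F}(T)$ coarsens the braid fan, whose cones are $\{x\in\mathbb{H}\mid x_u\le x_v\text{ whenever }u\preceq v\}$ for the total preorders $\preceq$ on $V$: each cone of the braid fan is contained in a cone of $\mathcal{F}(T)$, and each cone of $\mathcal{F}(T)$ is a union of cones of the braid fan. (3) For every linear order $\preceq$ on $V$ there is a unique signed spine $S$ on $T$ that is maximal (for the contraction order) and of which $\preceq$ is a linear extension, that is, $u\le_S v$ implies $u\preceq v$ for all $u,v\in V$. -/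

import Mathlib

open scoped BigOperators

noncomputable section

/-! ### Directed trees whose labels partition the ground set -/

/-- The undirected graph underlying a digraph on a set `nodes` of labels. -/
def labelGraph {V : Type*} (nodes : Set (Set V)) (Arc : Set V → Set V → Prop) :
    SimpleGraph nodes :=
  SimpleGraph.fromRel (fun A B : nodes => Arc A.1 B.1)

/-- A directed tree whose nodes are labeled by the parts of a partition of `V`. As the labels are
nonempty and pairwise disjoint, a node is identified with its label. -/
@[ext]
structure LabeledDirectedTree (V : Type*) where
  /-- the nodes (equivalently, their labels) -/
  nodes : Set (Set V)
  /-- `Arc A B`: there is an arc from the node `A` (source) to the node `B` (sink) -/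
  Arc : Set V → Set V → Prop
  /-- the labels are nonempty and each element of `V` lies in exactly one of them -/
  isPartition : Setoid.IsPartition nodes
  arc_mem : ∀ A B, Arc A B → A ∈ nodes ∧ B ∈ nodes
  /-- no loops and no pairs of opposite arcs -/
  arc_asymm : ∀ A B, Arc A B → ¬ Arc B A
  /-- the underlying undirected graph is a tree -/
  isTree : (labelGraph nodes Arc).IsTree

namespace LabeledDirectedTree

variable {V : Type*} (S : LabeledDirectedTree V)

/-- The underlying undirected tree. -/
def graph : SimpleGraph S.nodes := labelGraph S.nodes S.Arc

/-- The source label set of the arc `A → B`: the union of the labels of all the nodes in the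
connected component containing `A` of the tree with this arc deleted. -/
def sourceSet (A B : S.nodes) : Set V :=
  {v | ∃ C : S.nodes, v ∈ C.1 ∧ (S.graph.deleteEdges {s(A, B)}).Reachable C A}

/-- The sink label set of the arc `A → B`: the union of the labels of all the nodes in the
connected component containing `B` of the tree with this arc deleted. -/
def sinkSet (A B : S.nodes) : Set V :=
  {v | ∃ C : S.nodes, v ∈ C.1 ∧ (S.graph.deleteEdges {s(A, B)}).Reachable C B}

/-- The preposet on `V` given by the transitive closure of the tree: `u` is below `v` if there is
a directed path (possibly of length zero) from the node containing `u` to the one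
containing `v`. -/
def Below (u v : V) : Prop :=
  ∃ A ∈ S.nodes, ∃ B ∈ S.nodes, u ∈ A ∧ v ∈ B ∧ Relation.ReflTransGen S.Arc A B

open Classical in
/-- The new label of the node `C` when the nodes `A` and `B` are merged. -/
def mergeLabel (A B C : Set V) : Set V := if C = A ∨ C = B then A ∪ B else C

/-- `S'` is obtained from `S` by contracting a single arc `A → B` of `S`. -/
def IsArcContraction (S S' : LabeledDirectedTree V) : Prop :=
  ∃ A B, S.Arc A B ∧ S'.nodes = mergeLabel A B '' S.nodes ∧
    ∀ C D, S'.Arc C D ↔ ∃ C' D', S.Arc C' D' ∧ ¬ (C' = A ∧ D' = B) ∧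
      mergeLabel A B C' = C ∧ mergeLabel A B D' = D

end LabeledDirectedTree

/-! ### Signed spines -/

/-- A family `X` of subsets of `V` is contained in distinct connected components of `T ∖ U`:
there is an injective choice of a component of `T ∖ U` containing the given subset. -/
def InDistinctComponents {V ι : Type*} (T : SimpleGraph V) (U : Set V) (X : ι → Set V) : Prop :=
  ∃ f : ι → (T.induce Uᶜ).ConnectedComponent, Function.Injective f ∧
    ∀ i, X i ⊆ Subtype.val '' (f i).supp

/-- Signed spines on a tree `T` with vertex set `V`, with set of negative vertices `neg` and set of
positive vertices `negᶜ`. -/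
@[ext]
structure SignedSpine {V : Type*} (T : SimpleGraph V) (neg : Set V) extends
    LabeledDirectedTree V where
  /-- at each node `U`, the source label sets of the incoming arcs lie in distinct connected
  components of `T ∖ U⁻` -/
  incoming : ∀ U : nodes, InDistinctComponents T (U.1 ∩ neg)
    (fun A : {A : nodes // Arc A.1 U.1} => toLabeledDirectedTree.sourceSet A.1 U)
  /-- at each node `U`, the sink label sets of the outgoing arcs lie in distinct connected
  components of `T ∖ U⁺` -/
  outgoing : ∀ U : nodes, InDistinctComponents T (U.1 ∩ negᶜ)
    (fun B : {B : nodes // Arc U.1 B.1} => toLabeledDirectedTree.sinkSet U B.1)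

/-- The order of arc contractions: `S ≤ S'` if `S` is obtained from `S'` by contracting arcs. -/
instance {V : Type*} (T : SimpleGraph V) (neg : Set V) : Preorder (SignedSpine T neg) where
  le S S' := Relation.ReflTransGen
    (fun R R' : SignedSpine T neg => R.toLabeledDirectedTree.IsArcContraction
      R'.toLabeledDirectedTree) S' S
  le_refl _ := Relation.ReflTransGen.refl
  le_trans _ _ _ h h' := Relation.ReflTransGen.trans h' h

/-! ### Preposet cones, the spine fan and the braid fan -/

/-- The affine hyperplane `∑ v, x v = binom (ν + 1) 2` of `ℝ^V`, where `ν = |V|`. -/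
def hyperplaneH (V : Type*) [Fintype V] : Set (V → ℝ) :=
  {x | ∑ v, x v = (((Fintype.card V + 1).choose 2 : ℕ) : ℝ)}

/-- The point of `hyperplaneH V` all of whose coordinates are equal. -/
def centerH (V : Type*) [Fintype V] : V → ℝ := fun _ => ((Fintype.card V : ℝ) + 1) / 2

/-- The cone in `hyperplaneH V` of a binary relation (usually a preposet) on `V`. -/
def preposetCone {V : Type*} [Fintype V] (r : V → V → Prop) : Set (V → ℝ) :=
  {x | x ∈ hyperplaneH V ∧ ∀ u v, r u v → x u ≤ x v}

/-- The cone of a signed spine. -/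
def SignedSpine.cone {V : Type*} [Fintype V] {T : SimpleGraph V} {neg : Set V}
    (S : SignedSpine T neg) : Set (V → ℝ) :=
  preposetCone S.toLabeledDirectedTree.Below

/-- The collection of the cones of all signed spines on `T`. -/
def spineFan {V : Type*} [Fintype V] (T : SimpleGraph V) (neg : Set V) : Set (Set (V → ℝ)) :=
  Set.range (SignedSpine.cone : SignedSpine T neg → Set (V → ℝ))

/-- The braid fan: the cones of all linear preposets, i.e. of all total preorders on `V`. -/
def braidFan (V : Type*) [Fintype V] : Set (Set (V → ℝ)) :=
  {C | ∃ r : V → V → Prop, IsPreorder V r ∧ (∀ u v, r u v ∨ r v u) ∧ C = preposetCone r}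

/-! ### Fans -/

/-- The translate of the pointed cone `K` with apex `p`. -/
def coneAt {E : Type*} [AddCommGroup E] [Module ℝ E] (p : E) (K : PointedCone ℝ E) : Set E :=
  {x | x - p ∈ K}

/-- `F` is a complete simplicial fan on `H` (an affine subspace through `p`) with apex `p`:
a finite collection of simplicial cones with apex `p` that contains all faces of its members, such
that any two members intersect in a common face, and whose union is `H`. -/
structure IsCompleteSimplicialFan {E : Type*} [AddCommGroup E] [Module ℝ E] (H : Set E) (p : E)
    (F : Set (Set E)) : Prop where
  finite : F.Finite
  simplicial : ∀ C ∈ F, ∃ K : PointedCone ℝ E, K.IsSimplicial ∧ C = coneAt p K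
  face_mem : ∀ K K' : PointedCone ℝ E, coneAt p K ∈ F → K'.IsFaceOf K → coneAt p K' ∈ F
  inter_face : ∀ K K' : PointedCone ℝ E, coneAt p K ∈ F → coneAt p K' ∈ F →
    (K ⊓ K').IsFaceOf K ∧ (K ⊓ K').IsFaceOf K'
  sUnion_eq : ⋃₀ F = H

/-- The fan `F` coarsens the fan `G`: each cone of `G` is contained in a cone of `F`, and each cone
of `F` is a union of cones of `G`. -/
def FanCoarsens {E : Type*} (F G : Set (Set E)) : Prop :=
  (∀ D ∈ G, ∃ C ∈ F, D ⊆ C) ∧ ∀ C ∈ F, ∃ G' ⊆ G, C = ⋃₀ G'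

end

/-! # The fan of signed spines on a tree

The theorem rests on one fact: for every function `x : V → ℝ` there is exactly one signed spine for
which `x` is *strict*, that is, constant on the labels and strictly increasing along the arcs
(`LabeledDirectedTree.IsStrict`). In other words, the relative interiors of the cones of signed
spines partition the hyperplane.

*Presentation by cuts.* A tree is handled through its cuts: each arc `i` comes with the set `X i` of
nodes on its source side, no other arc crosses this set, and a predicate that does not change along
arcs is constant (`CutTree`). This replaces acyclicity and reachability, and makes reversal,
contraction and gluing of trees easy. The conditions on components of `T ∖ U` are restated through
the relation "`w` lies on the path from `u` to `v`" (`OnPath`), which gives the structure `SpineOn`;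
reversing the arcs and exchanging the signs preserves it (`SpineOn.flip`).

*Uniqueness* (`SignedSpine.eq_of_isStrict`). Let `x` be strict for a spine, and consider an arc
whose source lies in `D = {x < l}` while its target does not. Following the spine away from the arc,
one either moves monotonically or turns at a node whose vertices of the appropriate sign separate
what lies beyond (`SpineOn.descend_or_turn`). This relates the cut of the arc to the positive
vertices in `D` and the negative vertices outside `D` (`LevelCut`) so closely that it is determined
by `D` and two base points (`LevelCut.subset_of_base`). Two strict spines hence have the same cuts,
and the cuts determine the spine (`LabeledDirectedTree.eq_of_vertexCuts_eq`).

*Existence.* For a linear order, a spine with singleton labels is built by recursion on sets of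
vertices, adding the maximal vertex last (`VertexSpine.exists_increasing`). A general `x` is refined to a linear order, and
the arcs of the resulting spine along which `x` is constant are contracted
(`SignedSpine.exists_isStrict`). The same lemma describes the cone of the contracted spine as the
face of the original cone cut out by the equalities that hold for `x`.

*The theorem.* A face of a cone is the cone of the spine of a vector in the face that satisfies as
few equalities as possible. A vector in two cones has the same spine when contracted from either
side, so that the intersection is a face of both. The cone of a spine is generated by one vector per
arc, constant on both sides of its cut, and these vectors are independent since only one of them
changes across a given arc. Total preorders are represented by functions (`exists_rank`), which
gives the comparison with the braid fan; for a linear order this function is injective, so that it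
is strict for every spine of which the order is a linear extension, and uniqueness applies. -/

noncomputable section

/-! ### Paths in the ground tree -/

/-- The vertex `w` lies on every walk of `T` from `u` to `v`. In a tree, this says that `w` lies on
the path from `u` to `v`. -/
def OnPath {V : Type*} (T : SimpleGraph V) (u v w : V) : Prop :=
  ∀ p : T.Walk u v, w ∈ p.support

namespace OnPath

variable {V : Type*} {T : SimpleGraph V} {u v w y z : V}

lemma start : OnPath T u v u := fun p => p.start_mem_support

lemma finish : OnPath T u v v := fun p => p.end_mem_support

lemma symm (h : OnPath T u v w) : OnPath T v u w := fun p => by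
  have := h p.reverse
  simpa using this

lemma eq_of_self (h : OnPath T u u w) : w = u := by
  simpa using h SimpleGraph.Walk.nil

lemma split (v : V) (h : OnPath T u z w) : OnPath T u v w ∨ OnPath T v z w := by
  by_contra! hc
  simp only [OnPath, not_forall] at hc
  obtain ⟨⟨p, hp⟩, q, hq⟩ := hc
  have := h (p.append q)
  rw [SimpleGraph.Walk.mem_support_append_iff] at this
  tauto

lemma dist_add (hT : T.IsTree) (h : OnPath T u v w) : T.dist u w + T.dist w v = T.dist u v := by
  classical
  obtain ⟨p, hp⟩ := hT.1.exists_walk_length_eq_dist u v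
  have hw := h p
  have h1 := SimpleGraph.dist_le (p.takeUntil w hw)
  have h2 := SimpleGraph.dist_le (p.dropUntil w hw)
  have h3 := congrArg SimpleGraph.Walk.length (p.take_spec hw)
  rw [SimpleGraph.Walk.length_append] at h3
  have := hT.1.dist_triangle (u := u) (v := w) (w := v)
  omega

lemma of_dist_add (hT : T.IsTree) (h : T.dist u w + T.dist w v = T.dist u v) :
    OnPath T u v w := by
  classical
  obtain ⟨p, hp⟩ := hT.1.exists_walk_length_eq_dist u w
  obtain ⟨q, hq⟩ := hT.1.exists_walk_length_eq_dist w v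
  have hpath : (p.append q).IsPath := by
    apply SimpleGraph.Walk.isPath_of_length_eq_dist
    rw [SimpleGraph.Walk.length_append]; omega
  intro r
  have := (hT.2.subsingleton_path u v).elim ⟨_, hpath⟩ r.toPath
  have h2 : w ∈ (p.append q).support := by
    rw [SimpleGraph.Walk.mem_support_append_iff]; left; exact p.end_mem_support
  have h3 : p.append q = (r.toPath : T.Walk u v) := congrArg Subtype.val this
  rw [h3] at h2
  exact SimpleGraph.Walk.support_toPath_subset_support _ h2

/-- Two vertices that each separate the other one from a third vertex are equal. -/
lemma antisymm (hT : T.IsTree) (h₁ : OnPath T u v w) (h₂ : OnPath T u w v) : v = w := by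
  have := h₁.dist_add hT
  have := h₂.dist_add hT
  rw [SimpleGraph.dist_comm (u := w) (v := v)] at *
  exact (hT.1.dist_eq_zero_iff).1 (by omega)

lemma trans_left (hT : T.IsTree) (h₁ : OnPath T u v w) (h₂ : OnPath T u w y) : OnPath T u v y := by
  have h3 := h₁.dist_add hT
  have h4 := h₂.dist_add hT
  have := hT.1.dist_triangle (u := u) (v := y) (w := v)
  have := hT.1.dist_triangle (u := y) (v := w) (w := v)
  exact of_dist_add hT (by omega)

lemma trans_right (hT : T.IsTree) (h₁ : OnPath T u v w) (h₂ : OnPath T w v y) :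
    OnPath T u v y :=
  (h₁.symm.trans_left hT h₂.symm).symm

lemma dist_lt (hT : T.IsTree) (h : OnPath T u v w) (hne : w ≠ v) : T.dist u w < T.dist u v := by
  have := h.dist_add hT
  have := hT.1.pos_dist_of_ne hne
  omega

end OnPath

/-- In a tree, two vertices outside `U` are joined by a path avoiding `U` if and only if no vertex
of `U` lies on the path between them. -/
lemma reachable_induce_compl_iff {V : Type*} {T : SimpleGraph V} (hT : T.IsTree) {U : Set V}
    {u v : V} (hu : u ∉ U) (hv : v ∉ U) :
    (T.induce Uᶜ).Reachable ⟨u, hu⟩ ⟨v, hv⟩ ↔ ∀ w ∈ U, ¬ OnPath T u v w := by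
  constructor
  · rintro ⟨p⟩ w hw h
    have h1 : w ∈ (p.map (SimpleGraph.Embedding.induce Uᶜ).toHom).support :=
      h (p.map (SimpleGraph.Embedding.induce Uᶜ).toHom)
    rw [SimpleGraph.Walk.support_map, List.mem_map] at h1
    obtain ⟨a, -, rfl⟩ := h1
    exact a.2 hw
  · intro h
    classical
    obtain ⟨p, hp, huniq⟩ := hT.existsUnique_path u v
    have hsub : ∀ w ∈ p.support, w ∈ Uᶜ := by
      intro w hw hwU
      refine h w hwU fun q => ?_
      have := huniq _ q.toPath.2
      rw [← this] at hw
      exact SimpleGraph.Walk.support_toPath_subset_support _ hw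
    exact ⟨p.induce Uᶜ hsub⟩

lemma inDistinctComponents_iff {V ι : Type*} {T : SimpleGraph V} (hT : T.IsTree) {U : Set V}
    {X : ι → Set V} (hne : ∀ i, (X i).Nonempty) (hdisj : ∀ i, ∀ u ∈ X i, u ∉ U) :
    InDistinctComponents T U X ↔
      (∀ i, ∀ u ∈ X i, ∀ v ∈ X i, ∀ w ∈ U, ¬ OnPath T u v w) ∧
      (∀ i j, i ≠ j → ∀ u ∈ X i, ∀ v ∈ X j, ∃ w ∈ U, OnPath T u v w) := by
  constructor
  · rintro ⟨f, hf, hX⟩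
    have key : ∀ i, ∀ u (hu : u ∈ X i),
        (T.induce Uᶜ).connectedComponentMk ⟨u, hdisj i u hu⟩ = f i := by
      intro i u hu
      obtain ⟨⟨a, ha⟩, ha', rfl⟩ := hX i hu
      exact ha'
    constructor
    · intro i u hu v hv
      rw [← reachable_induce_compl_iff hT (hdisj i u hu) (hdisj i v hv)]
      exact SimpleGraph.ConnectedComponent.exact ((key i u hu).trans (key i v hv).symm)
    · intro i j hij u hu v hv
      by_contra! hc
      rw [← reachable_induce_compl_iff hT (hdisj i u hu) (hdisj j v hv)] at hc
      exact hij (hf (((key i u hu).symm.trans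
        (SimpleGraph.ConnectedComponent.sound hc)).trans (key j v hv)))
  · rintro ⟨h1, h2⟩
    choose a ha using hne
    refine ⟨fun i => (T.induce Uᶜ).connectedComponentMk ⟨a i, hdisj i _ (ha i)⟩, ?_, ?_⟩
    · intro i j hij
      by_contra hne
      obtain ⟨w, hw, hp⟩ := h2 i j hne _ (ha i) _ (ha j)
      exact (reachable_induce_compl_iff hT _ _).1 (SimpleGraph.ConnectedComponent.exact hij) w hw hp
    · intro i u hu
      refine ⟨⟨u, hdisj i u hu⟩, ?_, rfl⟩
      exact SimpleGraph.ConnectedComponent.sound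
        ((reachable_induce_compl_iff hT _ _).2 (h1 i _ hu _ (ha i)))

/-! ### Trees presented by their cuts -/

/-- A tree with node set `W`, arc set `J`, source and target maps `s` and `t`, presented by its
cuts: `X i` is the set of nodes on the source side of the arc `i`. Instead of acyclicity one asks
that no arc other than `i` crosses the cut `X i`; connectedness says that a predicate which
does not change along arcs is constant. -/
structure CutTree {N I : Type*} (W : Set N) (J : Set I) (s t : I → N) (X : I → Set N) : Prop where
  source_mem : ∀ i ∈ J, s i ∈ W
  target_mem : ∀ i ∈ J, t i ∈ W
  sub : ∀ i ∈ J, X i ⊆ W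
  left : ∀ i ∈ J, s i ∈ X i
  right : ∀ i ∈ J, t i ∉ X i
  cross : ∀ i ∈ J, ∀ j ∈ J, j ≠ i → (s j ∈ X i ↔ t j ∈ X i)
  conn : ∀ P : N → Prop, (∀ i ∈ J, (P (s i) ↔ P (t i))) → ∀ a ∈ W, ∀ b ∈ W, P a → P b

namespace CutTree

variable {N I : Type*} {W : Set N} {J : Set I} {s t : I → N} {X : I → Set N}

/-- The tree with all arcs reversed. -/
lemma flip (h : CutTree W J s t X) : CutTree W J t s (fun i => W \ X i) where
  source_mem := h.target_mem
  target_mem := h.source_mem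
  sub _ _ := Set.sdiff_subset
  left i hi := ⟨h.target_mem i hi, h.right i hi⟩
  right i hi h' := h'.2 (h.left i hi)
  cross i hi j hj hji := by
    have := h.cross i hi j hj hji
    simp [h.source_mem j hj, h.target_mem j hj, this]
  conn P hP := h.conn P fun i hi => (hP i hi).symm

/-- Every node other than `p` is beyond some arc at `p`. -/
lemma branch_cases (h : CutTree W J s t X) {p v : N} (hp : p ∈ W) (hv : v ∈ W) (hne : v ≠ p) :
    (∃ i ∈ J, s i = p ∧ v ∉ X i) ∨ (∃ i ∈ J, t i = p ∧ v ∈ X i) := by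
  have := h.conn (fun v => v = p ∨ (∃ i ∈ J, s i = p ∧ v ∉ X i) ∨ (∃ i ∈ J, t i = p ∧ v ∈ X i))
    ?_ p hp v hv (Or.inl rfl)
  · exact this.resolve_left hne
  · intro j hj
    by_cases h1 : s j = p
    · have : t j ∉ X j := h.right j hj
      constructor
      · intro _; exact Or.inr (Or.inl ⟨j, hj, h1, this⟩)
      · intro _; exact Or.inl h1
    · by_cases h2 : t j = p
      · have : s j ∈ X j := h.left j hj
        constructor
        · intro _; exact Or.inl h2
        · intro _; exact Or.inr (Or.inr ⟨j, hj, h2, this⟩)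
      · have key : ∀ i ∈ J, (s i = p ∨ t i = p) → (s j ∈ X i ↔ t j ∈ X i) := by
          intro i hi hip
          apply h.cross i hi j hj
          rintro rfl
          tauto
        simp only [h1, h2, false_or]
        constructor
        · rintro (⟨i, hi, rfl, hx⟩ | ⟨i, hi, rfl, hx⟩)
          · exact Or.inl ⟨i, hi, rfl, by rwa [← key i hi (Or.inl rfl)]⟩
          · exact Or.inr ⟨i, hi, rfl, by rwa [← key i hi (Or.inr rfl)]⟩
        · rintro (⟨i, hi, rfl, hx⟩ | ⟨i, hi, rfl, hx⟩)
          · exact Or.inl ⟨i, hi, rfl, by rwa [key i hi (Or.inl rfl)]⟩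
          · exact Or.inr ⟨i, hi, rfl, by rwa [key i hi (Or.inr rfl)]⟩

lemma cut_injective (h : CutTree W J s t X) {i j : I} (hi : i ∈ J) (hj : j ∈ J)
    (hX : X i = X j) : i = j := by
  by_contra hne
  have := h.cross i hi j hj (Ne.symm hne)
  rw [hX] at this
  exact h.right j hj (this.1 (h.left j hj))

/-- The cut of an arc into `p` is contained in the cut of an arc out of `p`. -/
lemma subset_of_target_eq_source (h : CutTree W J s t X) {i j : I} (hi : i ∈ J) (hj : j ∈ J)
    (hij : t i = s j) : X i ⊆ X j := by
  intro v hv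
  by_contra hvj
  have hne : i ≠ j := by rintro rfl; exact hvj hv
  have h1 := h.cross i hi j hj hne.symm
  have h2 := h.cross j hj i hi hne
  have h3 := h.left j hj
  have h4 := h.right i hi
  have h5 := h.conn (fun v => v ∈ X i ∧ v ∉ X j) ?_ v (h.sub i hi hv) (s j) (h.source_mem j hj)
    ⟨hv, hvj⟩
  · exact h5.2 h3
  · intro k hk
    by_cases hki : k = i
    · subst hki; rw [hij] at h2 ⊢; simp [h2, h3]
    · by_cases hkj : k = j
      · subst hkj; rw [hij] at h4; simp [h3, ← h1, h4]
      · simp only [h.cross i hi k hk hki, h.cross j hj k hk hkj]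

/-- The cuts of two different arcs into the same node are disjoint. -/
lemma disjoint_of_target_eq (h : CutTree W J s t X) {i j : I} (hi : i ∈ J) (hj : j ∈ J)
    (hne : i ≠ j) (hij : t i = t j) : ∀ v ∈ X i, v ∉ X j := by
  intro v hv hvj
  have h1 := h.cross i hi j hj hne.symm
  have h2 := h.cross j hj i hi hne
  have h3 := h.right j hj
  have h4 := h.right i hi
  have h5 := h.conn (fun v => v ∈ X i ∧ v ∈ X j) ?_ v (h.sub i hi hv) (t j) (h.target_mem j hj)
    ⟨hv, hvj⟩
  · exact h3 h5.2
  · intro k hk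
    by_cases hki : k = i
    · subst hki; simp [h2, hij, h3]
    · by_cases hkj : k = j
      · subst hkj; simp [h1, ← hij, h4]
      · simp only [h.cross i hi k hk hki, h.cross j hj k hk hkj]

end CutTree

/-! ### Spine conditions on trees presented by cuts -/

/-- The union of the labels of the nodes in `Y`. -/
def labelUnion {N V : Type*} (lab : N → Set V) (Y : Set N) : Set V :=
  {u | ∃ c ∈ Y, u ∈ lab c}

lemma labelUnion_mono {N V : Type*} {lab : N → Set V} {Y Z : Set N} (h : Y ⊆ Z) :
    labelUnion lab Y ⊆ labelUnion lab Z := fun _ ⟨c, hc, hu⟩ => ⟨c, h hc, hu⟩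

@[simp] lemma labelUnion_singleton {V : Type*} (Y : Set V) :
    labelUnion (fun v => ({v} : Set V)) Y = Y := by
  ext u; simp [labelUnion]

/-- A tree presented by its cuts whose nodes carry labels satisfying the conditions of a signed
spine, stated in terms of paths in `T`. The labels need not exhaust the vertices of `T`. -/
structure SpineOn {V N I : Type*} (T : SimpleGraph V) (neg : Set V) (W : Set N) (J : Set I)
    (s t : I → N) (X : I → Set N) (lab : N → Set V) : Prop extends CutTree W J s t X where
  in_same : ∀ i ∈ J, ∀ u ∈ labelUnion lab (X i), ∀ v ∈ labelUnion lab (X i),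
    ∀ w ∈ lab (t i), w ∈ neg → ¬ OnPath T u v w
  in_diff : ∀ i ∈ J, ∀ j ∈ J, i ≠ j → t i = t j → ∀ u ∈ labelUnion lab (X i),
    ∀ v ∈ labelUnion lab (X j), ∃ w ∈ lab (t i), w ∈ neg ∧ OnPath T u v w
  out_same : ∀ i ∈ J, ∀ u ∈ labelUnion lab (W \ X i), ∀ v ∈ labelUnion lab (W \ X i),
    ∀ w ∈ lab (s i), w ∉ neg → ¬ OnPath T u v w
  out_diff : ∀ i ∈ J, ∀ j ∈ J, i ≠ j → s i = s j → ∀ u ∈ labelUnion lab (W \ X i),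
    ∀ v ∈ labelUnion lab (W \ X j), ∃ w ∈ lab (s i), w ∉ neg ∧ OnPath T u v w

namespace SpineOn

variable {V N I : Type*} {T : SimpleGraph V} {neg : Set V} {W : Set N} {J : Set I}
  {s t : I → N} {X : I → Set N} {lab : N → Set V}

/-- Reversing all arcs and exchanging the signs preserves the spine conditions. -/
lemma flip (h : SpineOn T neg W J s t X lab) :
    SpineOn T negᶜ W J t s (fun i => W \ X i) lab := by
  have hX : ∀ i ∈ J, W \ (W \ X i) = X i := fun i hi => by
    rw [Set.sdiff_sdiff_right_self, Set.inter_eq_right.2 (h.sub i hi)]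
  refine ⟨h.toCutTree.flip, ?_, ?_, ?_, ?_⟩
  · intro i hi u hu v hv w hw hn
    exact h.out_same i hi u hu v hv w hw hn
  · intro i hi j hj hne hij u hu v hv
    exact h.out_diff i hi j hj hne hij u hu v hv
  · intro i hi u hu v hv w hw hn
    simp only [hX i hi] at hu hv
    exact h.in_same i hi u hu v hv w hw (not_not.1 hn)
  · intro i hi j hj hne hij u hu v hv
    simp only [hX i hi, hX j hj] at hu hv
    obtain ⟨w, hw, hn, hp⟩ := h.in_diff i hi j hj hne hij u hu v hv
    exact ⟨w, hw, fun h => h hn, hp⟩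

/-- Let `h` increase along arcs. For a node `e` on the source side of the arc `i`, the path of the
spine from the source of `i` to `e` either descends all the way, and then `e` is lower and its
positive vertices do not separate vertices of the target side, or it turns upward at a node
`s k`, whose positive vertices then separate what lies beyond `k` from the target side of `i`. -/
lemma descend_or_turn (h : SpineOn T neg W J s t X lab) {α : Type*} [LinearOrder α]
    [WellFoundedLT α] (f : N → α) (hf : ∀ i ∈ J, f (s i) < f (t i)) {i : I} (hi : i ∈ J)
    {e : N} (he : e ∈ X i) :
    (f e ≤ f (s i) ∧ ∀ w ∈ lab e, w ∉ neg → ∀ u ∈ labelUnion lab (W \ X i),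
      ∀ v ∈ labelUnion lab (W \ X i), ¬ OnPath T u v w) ∨
    ∃ k ∈ J, s k ∈ X i ∧ f (s k) ≤ f (s i) ∧ e ∉ X k ∧
      (∀ u ∈ labelUnion lab (W \ X k), ∀ v ∈ labelUnion lab (W \ X i),
        ∃ w ∈ lab (s k), w ∉ neg ∧ OnPath T u v w) ∧
      (∀ u ∈ labelUnion lab (W \ X i), ∀ v ∈ labelUnion lab (W \ X i), ∀ w ∈ lab (s k),
        w ∉ neg → ¬ OnPath T u v w) := by
  induction hn : f (s i) using WellFoundedLT.induction generalizing i with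
  | ind a ih =>
  subst hn
  by_cases hes : e = s i
  · subst hes
    exact Or.inl ⟨le_rfl, fun w hw hn u hu v hv => h.out_same i hi u hu v hv w hw hn⟩
  rcases h.branch_cases (h.source_mem i hi) (h.sub i hi he) hes with
    ⟨k, hk, hki, hek⟩ | ⟨k, hk, hki, hek⟩
  · right
    have hne : k ≠ i := by rintro rfl; exact hek he
    refine ⟨k, hk, hki ▸ h.left i hi, hki ▸ le_rfl, hek, h.out_diff k hk i hi hne hki, ?_⟩
    rw [hki]
    exact h.out_same i hi
  · have hlt : f (s k) < f (s i) := hki ▸ hf k hk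
    have hsub : X k ⊆ X i := h.subset_of_target_eq_source hk hi hki
    have hsub' : labelUnion lab (W \ X i) ⊆ labelUnion lab (W \ X k) :=
      labelUnion_mono (Set.sdiff_subset_sdiff_right hsub)
    rcases ih _ hlt hk hek rfl with ⟨h1, h2⟩ | ⟨l, hl, h1, h2, h3, h4, h5⟩
    · exact Or.inl ⟨h1.trans hlt.le, fun w hw hn u hu v hv =>
        h2 w hw hn u (hsub' hu) v (hsub' hv)⟩
    · exact Or.inr ⟨l, hl, hsub h1, h2.trans hlt.le, h3, fun u hu v hv => h4 u hu v (hsub' hv),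
        fun u hu v hv => h5 u (hsub' hu) v (hsub' hv)⟩

end SpineOn

/-! ### Cuts at a level -/

/-- Properties of the cut `X` of an arc of a spine that is compatible with a function on `V`, where
`D` is a strict lower level set of this function containing the label of the source but not the
label of the target of the arc. -/
structure LevelCut {V : Type*} (T : SimpleGraph V) (neg D X : Set V) : Prop where
  between_left : ∀ u ∈ X, ∀ v ∈ X, ∀ w ∉ X, OnPath T u v w → w ∉ neg ∧ w ∉ D
  between_right : ∀ u ∉ X, ∀ v ∉ X, ∀ w ∈ X, OnPath T u v w → w ∈ neg ∧ w ∈ D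
  sep_left : ∀ w ∉ X, w ∈ D → ∀ u ∈ X, ∃ z ∉ X, z ∈ neg ∧ z ∉ D ∧ OnPath T u w z
  sep_right : ∀ w ∈ X, w ∉ D → ∀ u ∉ X, ∃ z ∈ X, z ∉ neg ∧ z ∈ D ∧ OnPath T u w z

namespace LevelCut

variable {V : Type*} {T : SimpleGraph V} {neg D X Y : Set V}

/-- A level cut has base points: a low vertex in `X` and a high vertex outside `X` such that no low
positive and no high negative vertex lies strictly between them. -/
lemma exists_base [Finite V] (hT : T.IsTree) (h : LevelCut T neg D X) {a₀ b₀ : V} (ha₀ : a₀ ∈ X)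
    (ha₀D : a₀ ∈ D) (hb₀ : b₀ ∉ X) (hb₀D : b₀ ∉ D) :
    ∃ a ∈ X, a ∈ D ∧ ∃ b ∉ X, b ∉ D ∧ ∀ w, OnPath T a b w → (w ∈ D ↔ w ∉ neg) → w = a ∨ w = b := by
  -- a closest pair of a low vertex of `X` and a high vertex outside `X`
  have hne : ({p : V × V | (p.1 ∈ X ∧ p.1 ∈ D) ∧ p.2 ∉ X ∧ p.2 ∉ D}).Nonempty :=
    ⟨(a₀, b₀), ⟨ha₀, ha₀D⟩, hb₀, hb₀D⟩
  obtain ⟨⟨a, b⟩, ⟨⟨ha, haD⟩, hb, hbD⟩, hmin⟩ :=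
    Set.exists_min_image _ (fun p : V × V => T.dist p.1 p.2) (Set.toFinite _) hne
  refine ⟨a, ha, haD, b, hb, hbD, fun w hw hwall => ?_⟩
  by_contra! hc
  have hlow : ∀ z, OnPath T a b z → z ∈ X → z ∈ D → z = a := by
    intro z hz hzX hzD
    by_contra hza
    have h1 := hmin (z, b) ⟨⟨hzX, hzD⟩, hb, hbD⟩
    have h2 := hz.symm.dist_lt hT hza
    simp only [T.dist_comm (u := b)] at h2
    exact absurd h1 (not_le.2 h2)
  have hhigh : ∀ z, OnPath T a b z → z ∉ X → z ∉ D → z = b := by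
    intro z hz hzX hzD
    by_contra hzb
    have h1 := hmin (a, z) ⟨⟨ha, haD⟩, hzX, hzD⟩
    exact absurd h1 (not_le.2 (hz.dist_lt hT hzb))
  by_cases hwX : w ∈ X <;> by_cases hwD : w ∈ D
  · exact hc.1 (hlow w hw hwX hwD)
  · obtain ⟨z, hz, -, hzD, hp⟩ := h.sep_right w hwX hwD b hb
    have := hlow z (hw.trans_right hT hp.symm) hz hzD
    subst this
    exact hc.1 (OnPath.antisymm hT hw.symm hp).symm
  · obtain ⟨z, hz, -, hzD, hp⟩ := h.sep_left w hwX hwD a ha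
    have := hhigh z (hw.trans_left hT hp) hz hzD
    subst this
    exact hc.2 (OnPath.antisymm hT hw hp).symm
  · exact hc.2 (hhigh w hw hwX hwD)

/-- One inclusion between two cuts at the same level with common base points `a` and `b`: from a
vertex in `X` outside `Y` one finds another one that is closer to the path from `a` to `b`. -/
lemma subset_of_base [Finite V] (hT : T.IsTree) (hX : LevelCut T neg D X) (hY : LevelCut T neg D Y)
    {a b : V} (haX : a ∈ X) (haY : a ∈ Y) (haD : a ∈ D) (hbX : b ∉ X) (hbY : b ∉ Y) (hbD : b ∉ D)
    (hab : ∀ w, OnPath T a b w → (w ∈ D ↔ w ∉ neg) → w = a ∨ w = b) : X ⊆ Y := by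
  intro v₀ hv₀
  by_contra hv₀Y
  obtain ⟨v, ⟨hvX, hvY⟩, hmin⟩ := Set.exists_min_image {v | v ∈ X ∧ v ∉ Y}
    (fun v => T.dist a v + T.dist b v) (Set.toFinite _) ⟨v₀, hv₀, hv₀Y⟩
  have hdist : ∀ z, z ∈ X → z ∉ Y → (z ∈ D ↔ z ∉ neg) → z ≠ v → OnPath T a v z ∨ OnPath T b v z →
      False := by
    intro z hzX hzY hwall hne hp
    have hz : ¬ OnPath T a b z := fun hz => by
      rcases hab z hz hwall with rfl | rfl
      · exact hzY haY
      · exact hbX hzX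
    have h1 : OnPath T a v z := hp.elim id fun hp => (hp.split a).resolve_left fun h => hz h.symm
    have h2 : OnPath T b v z := hp.elim (fun hp => (hp.split b).resolve_left hz) id
    have := hmin z ⟨hzX, hzY⟩
    have := h1.dist_lt hT hne
    have := h2.dist_lt hT hne
    omega
  by_cases hvD : v ∈ D
  · obtain ⟨z, hzY, hzn, hzD, hp⟩ := hY.sep_left v hvY hvD a haY
    refine hdist z ?_ hzY (by tauto) (by rintro rfl; exact hzD hvD) (Or.inl hp)
    by_contra hzX
    exact (hX.between_left a haX v hvX z hzX hp).1 hzn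
  · obtain ⟨z, hzX, hzn, hzD, hp⟩ := hX.sep_right v hvX hvD b hbX
    refine hdist z hzX ?_ (by tauto) (by rintro rfl; exact hvD hzD) (Or.inr hp)
    intro hzY
    exact hzn (hY.between_right b hbY v hvY z hzY hp).1

end LevelCut

namespace SpineOn

variable {V N I : Type*} {T : SimpleGraph V} {neg : Set V} {W : Set N} {J : Set I}
  {s t : I → N} {X : I → Set N} {lab : N → Set V}

/-- The vertex cut of an arc of a spine whose labels partition `V` is a level cut, at every level
strictly above its source and not above its target. -/
lemma levelCut (hT : T.IsTree) (h : SpineOn T neg W J s t X lab) (hcov : ∀ v, ∃ c ∈ W, v ∈ lab c)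
    (hdisj : ∀ c ∈ W, ∀ d ∈ W, ∀ v, v ∈ lab c → v ∈ lab d → c = d)
    [Finite N] (f : N → ℝ) (hf : ∀ i ∈ J, f (s i) < f (t i)) {i : I} (hi : i ∈ J)
    {D : Set V} {l : ℝ} (hD : ∀ c ∈ W, ∀ v ∈ lab c, v ∈ D ↔ f c < l) (hl : f (s i) < l)
    (hl' : l ≤ f (t i)) : LevelCut T neg D (labelUnion lab (X i)) := by
  have hcompl : ∀ v, v ∉ labelUnion lab (X i) → v ∈ labelUnion lab (W \ X i) := by
    intro v hv
    obtain ⟨c, hc, hvc⟩ := hcov v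
    exact ⟨c, ⟨hc, fun hcX => hv ⟨c, hcX, hvc⟩⟩, hvc⟩
  have hcompl' : ∀ v, v ∈ labelUnion lab (W \ X i) → v ∉ labelUnion lab (X i) := by
    rintro v ⟨c, ⟨hc, hcX⟩, hvc⟩ ⟨d, hd, hvd⟩
    exact hcX (hdisj c hc d (h.sub i hi hd) v hvc hvd ▸ hd)
  -- `descend_or_turn` needs well-founded values: the finitely many values of `f` and their dual
  have hg : ∀ c : N, f c ∈ Set.range f := fun c => ⟨c, rfl⟩
  have hfin : Finite (Set.range f) := Set.finite_range f
  have hfin' : Finite (Set.range f)ᵒᵈ := hfin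
  have key₁ := fun {e : N} => h.descend_or_turn (α := Set.range f)
    (fun c => ⟨f c, hg c⟩) hf hi (e := e)
  have key₂ := fun {e : N} => h.flip.descend_or_turn (α := (Set.range f)ᵒᵈ)
    (fun c => OrderDual.toDual ⟨f c, hg c⟩) hf hi (e := e)
  have hX : W \ (W \ X i) = X i := by
    rw [Set.sdiff_sdiff_right_self, Set.inter_eq_right.2 (h.sub i hi)]
  simp only [hX, Set.notMem_compl_iff] at key₂
  constructor
  · intro u hu v hv w hw hp
    obtain ⟨e, he, hwe⟩ := hcompl w hw
    rcases key₂ he with ⟨h1, h2⟩ | ⟨k, hk, h1, h2, h3, h4, h5⟩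
    · have h1 : f (t i) ≤ f e := h1
      refine ⟨fun hn => h2 w hwe hn u hu v hv hp, ?_⟩
      rw [hD e he.1 w hwe]; linarith
    · exfalso
      obtain ⟨z, hz, hzn, hp'⟩ := h4 w ⟨e, ⟨he.1, h3⟩, hwe⟩ u hu
      exact h5 u hu v hv z hz hzn (hp.trans_left hT hp'.symm)
  · intro u hu v hv w hw hp
    obtain ⟨e, he, hwe⟩ := hw
    rcases key₁ he with ⟨h1, h2⟩ | ⟨k, hk, h1, h2, h3, h4, h5⟩
    · have h1 : f e ≤ f (s i) := h1
      refine ⟨by_contra fun hn => h2 w hwe hn u (hcompl u hu) v (hcompl v hv) hp, ?_⟩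
      rw [hD e (h.sub i hi he) w hwe]; linarith
    · exfalso
      obtain ⟨z, hz, hzn, hp'⟩ := h4 w ⟨e, ⟨h.sub i hi he, h3⟩, hwe⟩ u (hcompl u hu)
      exact h5 u (hcompl u hu) v (hcompl v hv) z hz hzn (hp.trans_left hT hp'.symm)
  · intro w hw hwD u hu
    obtain ⟨e, he, hwe⟩ := hcompl w hw
    rcases key₂ he with ⟨h1, h2⟩ | ⟨k, hk, h1, h2, h3, h4, h5⟩
    · have h1 : f (t i) ≤ f e := h1
      rw [hD e he.1 w hwe] at hwD; linarith
    · have h2 : f (t i) ≤ f (t k) := h2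
      obtain ⟨z, hz, hzn, hp'⟩ := h4 w ⟨e, ⟨he.1, h3⟩, hwe⟩ u hu
      refine ⟨z, hcompl' z ⟨_, h1, hz⟩, hzn, ?_, hp'.symm⟩
      rw [hD _ h1.1 z hz]; linarith
  · intro w hw hwD u hu
    obtain ⟨e, he, hwe⟩ := hw
    rcases key₁ he with ⟨h1, h2⟩ | ⟨k, hk, h1, h2, h3, h4, h5⟩
    · have h1 : f e ≤ f (s i) := h1
      rw [hD e (h.sub i hi he) w hwe] at hwD; linarith
    · have h2 : f (s k) ≤ f (s i) := h2
      obtain ⟨z, hz, hzn, hp'⟩ := h4 w ⟨e, ⟨h.sub i hi he, h3⟩, hwe⟩ u (hcompl u hu)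
      refine ⟨z, ⟨_, h1, hz⟩, hzn, ?_, hp'.symm⟩
      rw [hD _ (h.sub i hi h1) z hz]; linarith

end SpineOn

/-! ### Signed spines and their cuts -/

lemma SimpleGraph.Reachable.invariant {N : Type*} {G : SimpleGraph N} {P : N → Prop}
    (hP : ∀ a b, G.Adj a b → P a → P b) {a b : N} (h : G.Reachable a b) (ha : P a) : P b := by
  obtain ⟨p⟩ := h
  induction p with
  | nil => exact ha
  | cons hadj _ ih => exact ih (hP _ _ hadj ha)

namespace LabeledDirectedTree

variable {V : Type*} (S : LabeledDirectedTree V)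

/-- The arcs of a labeled directed tree, as pairs of nodes. -/
def arcs : Set (S.nodes × S.nodes) := {p | S.Arc p.1.1 p.2.1}

/-- The set of nodes on the source side of an arc. -/
def cut (p : S.nodes × S.nodes) : Set S.nodes :=
  {C | (S.graph.deleteEdges {s(p.1, p.2)}).Reachable C p.1}

variable {S}

lemma arc_ne {A B : S.nodes} (h : S.Arc A.1 B.1) : A ≠ B := by
  rintro rfl; exact S.arc_asymm _ _ h h

lemma graph_adj {A B : S.nodes} : S.graph.Adj A B ↔ S.Arc A.1 B.1 ∨ S.Arc B.1 A.1 := by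
  rw [graph, labelGraph, SimpleGraph.fromRel_adj]
  refine ⟨fun h => h.2, fun h => ⟨?_, h⟩⟩
  rcases h with h | h
  · exact arc_ne h
  · exact (arc_ne h).symm

lemma deleteEdges_adj {p q : S.nodes × S.nodes} (hp : p ∈ S.arcs) (hq : q ∈ S.arcs) (hne : q ≠ p) :
    (S.graph.deleteEdges {s(p.1, p.2)}).Adj q.1 q.2 := by
  rw [SimpleGraph.deleteEdges_adj, Set.mem_singleton_iff]
  refine ⟨graph_adj.2 (Or.inl hq), fun h => ?_⟩
  rw [Sym2.eq_iff] at h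
  rcases h with ⟨h1, h2⟩ | ⟨h1, h2⟩
  · exact hne (Prod.ext h1 h2)
  · have hq' : S.Arc q.1.1 q.2.1 := hq
    rw [h1, h2] at hq'
    exact S.arc_asymm _ _ hp hq'

/-- A labeled directed tree is presented by its cuts. -/
lemma cutTree (S : LabeledDirectedTree V) :
    CutTree Set.univ S.arcs Prod.fst Prod.snd S.cut where
  source_mem _ _ := Set.mem_univ _
  target_mem _ _ := Set.mem_univ _
  sub _ _ := Set.subset_univ _
  left p _ := SimpleGraph.Reachable.refl _
  right p hp h := by
    have hadj : S.graph.Adj p.1 p.2 := graph_adj.2 (Or.inl hp)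
    have := SimpleGraph.isAcyclic_iff_forall_adj_isBridge.1 S.isTree.2 hadj
    exact SimpleGraph.isBridge_iff.1 this h.symm
  cross p hp q hq hne := by
    have h := (deleteEdges_adj hp hq hne).reachable
    exact ⟨fun h' => h.symm.trans h', fun h' => h.trans h'⟩
  conn P hP a _ b _ ha := by
    refine (S.isTree.1.preconnected a b).invariant (P := P) ?_ ha
    intro A B hAB hA
    rcases graph_adj.1 hAB with h | h
    · exact (hP (A, B) h).1 hA
    · exact (hP (B, A) h).2 hA

lemma notMem_cut_iff {p : S.nodes × S.nodes} (hp : p ∈ S.arcs) {C : S.nodes} :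
    C ∉ S.cut p ↔ (S.graph.deleteEdges {s(p.1, p.2)}).Reachable C p.2 := by
  constructor
  · intro hC
    have := S.cutTree.conn
      (fun C => C ∈ S.cut p ∨ (S.graph.deleteEdges {s(p.1, p.2)}).Reachable C p.2) ?_ p.1 trivial C
      trivial (Or.inl (S.cutTree.left p hp))
    · exact this.resolve_left hC
    · intro q hq
      by_cases hqp : q = p
      · subst hqp
        exact ⟨fun _ => Or.inr (SimpleGraph.Reachable.refl _),
          fun _ => Or.inl (S.cutTree.left q hq)⟩
      · have h := (deleteEdges_adj hp hq hqp).reachable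
        rw [S.cutTree.cross p hp q hq hqp]
        exact or_congr Iff.rfl ⟨fun h' => h.symm.trans h', fun h' => h.trans h'⟩
  · intro h hC
    exact S.cutTree.right p hp (h.symm.trans hC)

lemma sourceSet_eq (A B : S.nodes) : S.sourceSet A B = labelUnion Subtype.val (S.cut (A, B)) := by
  ext u
  constructor
  · rintro ⟨C, hu, hC⟩; exact ⟨C, hC, hu⟩
  · rintro ⟨C, hC, hu⟩; exact ⟨C, hu, hC⟩

lemma sinkSet_eq {A B : S.nodes} (h : S.Arc A.1 B.1) :
    S.sinkSet A B = labelUnion Subtype.val (Set.univ \ S.cut (A, B)) := by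
  ext u
  constructor
  · rintro ⟨C, hu, hC⟩; exact ⟨C, ⟨trivial, (notMem_cut_iff (p := (A, B)) h).2 hC⟩, hu⟩
  · rintro ⟨C, hC, hu⟩; exact ⟨C, hu, (notMem_cut_iff (p := (A, B)) h).1 hC.2⟩

lemma node_eq {A B : S.nodes} {v : V} (hA : v ∈ A.1) (hB : v ∈ B.1) : A = B :=
  Subtype.ext (S.isPartition.2 v |>.unique ⟨A.2, hA⟩ ⟨B.2, hB⟩)

lemma exists_node (S : LabeledDirectedTree V) (v : V) : ∃ A : S.nodes, v ∈ A.1 := by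
  obtain ⟨A, ⟨hA, hv⟩, -⟩ := S.isPartition.2 v
  exact ⟨⟨A, hA⟩, hv⟩

lemma node_nonempty (A : S.nodes) : A.1.Nonempty :=
  Setoid.nonempty_of_mem_partition S.isPartition A.2

lemma mem_labelUnion_iff {A : S.nodes} {v : V} (hv : v ∈ A.1) {Y : Set S.nodes} :
    v ∈ labelUnion (Subtype.val : S.nodes → Set V) Y ↔ A ∈ Y := by
  constructor
  · rintro ⟨B, hB, hvB⟩; exact node_eq hv hvB ▸ hB
  · intro h; exact ⟨A, h, hv⟩

end LabeledDirectedTree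

open LabeledDirectedTree

/-- A signed spine satisfies the spine conditions in terms of paths. -/
lemma SignedSpine.spineOn {V : Type*} {T : SimpleGraph V} (hT : T.IsTree) {neg : Set V}
    (S : SignedSpine T neg) :
    SpineOn T neg Set.univ S.arcs Prod.fst Prod.snd S.cut Subtype.val := by
  have hin : ∀ U : S.nodes, _ := fun U => (inDistinctComponents_iff hT (fun A => by
      obtain ⟨u, hu⟩ := S.node_nonempty A.1
      exact ⟨u, A.1, hu, SimpleGraph.Reachable.refl _⟩) (fun A u hu hU => by
      simp only [sourceSet_eq] at hu
      rw [mem_labelUnion_iff hU.1] at hu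
      exact S.cutTree.right (A.1, U) A.2 hu)).1 (S.incoming U)
  have hout : ∀ U : S.nodes, _ := fun U => (inDistinctComponents_iff hT (fun B => by
      obtain ⟨u, hu⟩ := S.node_nonempty B.1
      exact ⟨u, B.1, hu, SimpleGraph.Reachable.refl _⟩) (fun B u hu hU => by
      simp only [sinkSet_eq B.2] at hu
      rw [mem_labelUnion_iff hU.1] at hu
      exact hu.2 (S.cutTree.left (U, B.1) B.2))).1 (S.outgoing U)
  refine ⟨S.cutTree, ?_, ?_, ?_, ?_⟩
  · rintro ⟨A, U⟩ hi u hu v hv w hw hn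
    have := (hin U).1 ⟨A, hi⟩ u (by rwa [sourceSet_eq]) v (by rwa [sourceSet_eq])
    exact this w ⟨hw, hn⟩
  · rintro ⟨A, U⟩ hi ⟨B, U'⟩ hj hne (rfl : U = U') u hu v hv
    obtain ⟨w, hw, hp⟩ := (hin U).2 ⟨A, hi⟩ ⟨B, hj⟩ (by
      intro h; exact hne (Prod.ext (congrArg Subtype.val h) rfl)) u (by rwa [sourceSet_eq]) v
      (by rwa [sourceSet_eq])
    exact ⟨w, hw.1, hw.2, hp⟩
  · rintro ⟨U, A⟩ hi u hu v hv w hw hn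
    have := (hout U).1 ⟨A, hi⟩ u (by rwa [sinkSet_eq hi]) v (by rwa [sinkSet_eq hi])
    exact this w ⟨hw, hn⟩
  · rintro ⟨U, A⟩ hi ⟨U', B⟩ hj hne (rfl : U = U') u hu v hv
    obtain ⟨w, hw, hp⟩ := (hout U).2 ⟨A, hi⟩ ⟨B, hj⟩ (by
      intro h; exact hne (Prod.ext rfl (congrArg Subtype.val h))) u (by rwa [sinkSet_eq hi]) v
      (by rwa [sinkSet_eq hj])
    exact ⟨w, hw.1, hw.2, hp⟩

/-! ### Constructing signed spines -/

namespace CutTree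

variable {V N I : Type*} {W : Set N} {J : Set I}
  {s t : I → N} {X : I → Set N} {lab : N → Set V}

/-- The arc relation induced on the labels of the nodes. -/
def LabelArc (J : Set I) (s t : I → N) (lab : N → Set V) (A B : Set V) : Prop :=
  ∃ i ∈ J, lab (s i) = A ∧ lab (t i) = B

lemma endpoints_ne (h : CutTree W J s t X) {i j : I} (hi : i ∈ J) (hj : j ∈ J) (hne : j ≠ i) :
    ¬ (s j = s i ∧ t j = t i) ∧ ¬ (s j = t i ∧ t j = s i) := by
  have h1 := h.cross i hi j hj hne
  have h2 := h.left i hi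
  have h3 := h.right i hi
  constructor <;> rintro ⟨h4, h5⟩ <;> rw [h4, h5] at h1 <;> tauto

/-- The node of the graph `labelGraph` of a labeled cut tree that corresponds to `c`. -/
def labelNode (lab : N → Set V) {c : N} (hc : c ∈ W) : lab '' W := ⟨lab c, c, hc, rfl⟩

lemma labelArc_asymm (h : CutTree W J s t X) (hinj : Set.InjOn lab W) {A B : Set V}
    (hAB : LabelArc J s t lab A B) : ¬ LabelArc J s t lab B A := by
  obtain ⟨i, hi, rfl, rfl⟩ := hAB
  rintro ⟨j, hj, h1, h2⟩
  have h1 := hinj (h.source_mem j hj) (h.target_mem i hi) h1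
  have h2 := hinj (h.target_mem j hj) (h.source_mem i hi) h2
  by_cases hij : j = i
  · subst hij
    exact h.right j hj (h1 ▸ h.left j hj)
  · exact (h.endpoints_ne hi hj hij).2 ⟨h1, h2⟩

lemma labelGraph_adj (h : CutTree W J s t X) (hinj : Set.InjOn lab W) {A B : lab '' W} :
    (labelGraph (lab '' W) (LabelArc J s t lab)).Adj A B ↔
      LabelArc J s t lab A.1 B.1 ∨ LabelArc J s t lab B.1 A.1 := by
  rw [labelGraph, SimpleGraph.fromRel_adj]
  refine ⟨fun h => h.2, fun h' => ⟨?_, h'⟩⟩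
  rintro rfl
  rcases h' with h' | h' <;> exact h.labelArc_asymm hinj h' h'

lemma deleteEdges_adj (h : CutTree W J s t X) (hinj : Set.InjOn lab W) {i : I} (hi : i ∈ J)
    {A B : lab '' W} :
    ((labelGraph (lab '' W) (LabelArc J s t lab)).deleteEdges
      {s(labelNode lab (h.source_mem i hi), labelNode lab (h.target_mem i hi))}).Adj A B ↔
    ∃ j, ∃ hj : j ∈ J, j ≠ i ∧
      ((A = labelNode lab (h.source_mem j hj) ∧ B = labelNode lab (h.target_mem j hj)) ∨
      (B = labelNode lab (h.source_mem j hj) ∧ A = labelNode lab (h.target_mem j hj))) := by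
  have hlab : ∀ {c d : N} (hc : c ∈ W) (hd : d ∈ W), labelNode lab hc = labelNode lab hd → c = d :=
    fun hc hd hcd => hinj hc hd (congrArg Subtype.val hcd)
  rw [SimpleGraph.deleteEdges_adj, h.labelGraph_adj hinj, Set.mem_singleton_iff, Sym2.eq_iff]
  constructor
  · rintro ⟨⟨j, hj, h1, h2⟩ | ⟨j, hj, h1, h2⟩, hne⟩
    · have hA : A = labelNode lab (h.source_mem j hj) := Subtype.ext h1.symm
      have hB : B = labelNode lab (h.target_mem j hj) := Subtype.ext h2.symm
      refine ⟨j, hj, ?_, Or.inl ⟨hA, hB⟩⟩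
      rintro rfl
      exact hne (Or.inl ⟨hA, hB⟩)
    · have hA : B = labelNode lab (h.source_mem j hj) := Subtype.ext h1.symm
      have hB : A = labelNode lab (h.target_mem j hj) := Subtype.ext h2.symm
      refine ⟨j, hj, ?_, Or.inr ⟨hA, hB⟩⟩
      rintro rfl
      exact hne (Or.inr ⟨hB, hA⟩)
  · rintro ⟨j, hj, hne, ⟨rfl, rfl⟩ | ⟨rfl, rfl⟩⟩
    · refine ⟨Or.inl ⟨j, hj, rfl, rfl⟩, ?_⟩
      have := h.endpoints_ne hi hj hne
      rintro (⟨h1, h2⟩ | ⟨h1, h2⟩)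
      · exact this.1 ⟨hlab _ _ h1, hlab _ _ h2⟩
      · exact this.2 ⟨hlab _ _ h1, hlab _ _ h2⟩
    · refine ⟨Or.inr ⟨j, hj, rfl, rfl⟩, ?_⟩
      have := h.endpoints_ne hi hj hne
      rintro (⟨h1, h2⟩ | ⟨h1, h2⟩)
      · exact this.2 ⟨hlab _ _ h2, hlab _ _ h1⟩
      · exact this.1 ⟨hlab _ _ h2, hlab _ _ h1⟩

/-- Together with `mem_cut_of_reachable`, this identifies the sides of the cut `X i` with the two
components of the graph without the arc `i`. -/
lemma reachable_of_conn (h : CutTree W J s t X) (hinj : Set.InjOn lab W) {i : I} (hi : i ∈ J)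
    {c : N} (hc : c ∈ W) :
    (c ∈ X i → ((labelGraph (lab '' W) (LabelArc J s t lab)).deleteEdges
      {s(labelNode lab (h.source_mem i hi), labelNode lab (h.target_mem i hi))}).Reachable
      (labelNode lab hc) (labelNode lab (h.source_mem i hi))) ∧
    (c ∉ X i → ((labelGraph (lab '' W) (LabelArc J s t lab)).deleteEdges
      {s(labelNode lab (h.source_mem i hi), labelNode lab (h.target_mem i hi))}).Reachable
      (labelNode lab hc) (labelNode lab (h.target_mem i hi))) := by
  set G := (labelGraph (lab '' W) (LabelArc J s t lab)).deleteEdges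
      {s(labelNode lab (h.source_mem i hi), labelNode lab (h.target_mem i hi))} with hG
  have := h.conn (fun c => ∀ hc : c ∈ W,
    (c ∈ X i → G.Reachable (labelNode lab hc) (labelNode lab (h.source_mem i hi))) ∧
    (c ∉ X i → G.Reachable (labelNode lab hc) (labelNode lab (h.target_mem i hi)))) ?_
    (s i) (h.source_mem i hi) c hc
    (fun hc => ⟨fun _ => SimpleGraph.Reachable.refl _, fun hn => absurd (h.left i hi) hn⟩)
  · exact this hc
  · intro j hj
    by_cases hji : j = i
    · subst hji
      exact ⟨fun _ hc =>
          ⟨fun hn => absurd hn (h.right j hj), fun _ => SimpleGraph.Reachable.refl _⟩,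
        fun _ hc => ⟨fun _ => SimpleGraph.Reachable.refl _, fun hn => absurd (h.left j hj) hn⟩⟩
    · have hadj : G.Reachable (labelNode lab (h.source_mem j hj))
          (labelNode lab (h.target_mem j hj)) :=
        ((h.deleteEdges_adj hinj hi).2 ⟨j, hj, hji, Or.inl ⟨rfl, rfl⟩⟩).reachable
      rw [h.cross i hi j hj hji]
      exact ⟨fun h' _ => ⟨fun hx => hadj.symm.trans ((h' (h.source_mem j hj)).1 hx),
          fun hx => hadj.symm.trans ((h' (h.source_mem j hj)).2 hx)⟩,
        fun h' _ => ⟨fun hx => hadj.trans ((h' (h.target_mem j hj)).1 hx),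
          fun hx => hadj.trans ((h' (h.target_mem j hj)).2 hx)⟩⟩

lemma mem_cut_of_reachable (h : CutTree W J s t X) (hinj : Set.InjOn lab W) {i : I} (hi : i ∈ J)
    {c d : N} (hc : c ∈ W) (hd : d ∈ W)
    (hr : ((labelGraph (lab '' W) (LabelArc J s t lab)).deleteEdges
      {s(labelNode lab (h.source_mem i hi), labelNode lab (h.target_mem i hi))}).Reachable
      (labelNode lab hc) (labelNode lab hd)) : c ∈ X i ↔ d ∈ X i := by
  have := hr.invariant (P := fun A => ∀ d, ∀ hd : d ∈ W, A = labelNode lab hd → (c ∈ X i ↔ d ∈ X i))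
    ?_ ?_
  · exact this d hd rfl
  · intro A B hAB hA d hd hBd
    obtain ⟨j, hj, hne, ⟨h1, h2⟩ | ⟨h1, h2⟩⟩ := (h.deleteEdges_adj hinj hi).1 hAB
    · have h3 := hA _ _ h1
      have h4 : d = t j := hinj hd (h.target_mem j hj) (congrArg Subtype.val (hBd.symm.trans h2))
      rw [h3, h4, h.cross i hi j hj hne]
    · have h3 := hA _ _ h2
      have h4 : d = s j := hinj hd (h.source_mem j hj) (congrArg Subtype.val (hBd.symm.trans h1))
      rw [h3, h4, h.cross i hi j hj hne]
  · intro d hd hcd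
    rw [hinj hc hd (congrArg Subtype.val hcd)]

/-- The labeled directed tree described by a tree presented by its cuts whose labels form a
partition. -/
def toLabeledDirectedTree (h : CutTree W J s t X) (hinj : Set.InjOn lab W)
    (hpart : Setoid.IsPartition (lab '' W)) (hW : W.Nonempty) : LabeledDirectedTree V where
  nodes := lab '' W
  Arc := LabelArc J s t lab
  isPartition := hpart
  arc_mem := by
    rintro A B ⟨i, hi, rfl, rfl⟩
    exact ⟨⟨_, h.source_mem i hi, rfl⟩, _, h.target_mem i hi, rfl⟩
  arc_asymm A B hAB := h.labelArc_asymm hinj hAB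
  isTree := by
    obtain ⟨c₀, hc₀⟩ := hW
    constructor
    · have : Nonempty (lab '' W) := ⟨labelNode lab hc₀⟩
      refine ⟨?_⟩
      rintro ⟨_, c, hc, rfl⟩ ⟨_, d, hd, rfl⟩
      have := h.conn (fun d => ∀ hd : d ∈ W, (labelGraph (lab '' W) (LabelArc J s t lab)).Reachable
        (labelNode lab hc) (labelNode lab hd)) ?_ c hc d hd (fun _ => SimpleGraph.Reachable.refl _)
      · exact this hd
      · intro j hj
        have hadj : (labelGraph (lab '' W) (LabelArc J s t lab)).Reachable
            (labelNode lab (h.source_mem j hj)) (labelNode lab (h.target_mem j hj)) :=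
          ((h.labelGraph_adj hinj).2 (Or.inl ⟨j, hj, rfl, rfl⟩)).reachable
        exact ⟨fun h' _ => (h' (h.source_mem j hj)).trans hadj,
          fun h' _ => (h' (h.target_mem j hj)).trans hadj.symm⟩
    · rw [SimpleGraph.isAcyclic_iff_forall_adj_isBridge]
      have key : ∀ i (hi : i ∈ J), ¬ ((labelGraph (lab '' W) (LabelArc J s t lab)).deleteEdges
          {s(labelNode lab (h.source_mem i hi), labelNode lab (h.target_mem i hi))}).Reachable
          (labelNode lab (h.source_mem i hi)) (labelNode lab (h.target_mem i hi)) := by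
        intro i hi hr
        have := h.mem_cut_of_reachable hinj hi _ _ hr
        exact h.right i hi (this.1 (h.left i hi))
      rintro ⟨A, hA⟩ ⟨B, hB⟩ hAB
      rcases (h.labelGraph_adj hinj).1 hAB with ⟨i, hi, h1, h2⟩ | ⟨i, hi, h1, h2⟩
      · simp only at h1 h2
        subst h1 h2
        exact SimpleGraph.isBridge_iff.2 (key i hi)
      · simp only at h1 h2
        subst h1 h2
        rw [Sym2.eq_swap]
        exact SimpleGraph.isBridge_iff.2 (key i hi)

lemma sourceSet_toLabeledDirectedTree (h : CutTree W J s t X) (hinj : Set.InjOn lab W)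
    (hpart : Setoid.IsPartition (lab '' W)) (hW : W.Nonempty) {i : I} (hi : i ∈ J) :
    (h.toLabeledDirectedTree hinj hpart hW).sourceSet (labelNode lab (h.source_mem i hi))
      (labelNode lab (h.target_mem i hi)) = labelUnion lab (X i) := by
  ext u
  constructor
  · rintro ⟨⟨_, c, hc, rfl⟩, hu, hr⟩
    exact ⟨c, (h.mem_cut_of_reachable hinj hi hc _ hr).2 (h.left i hi), hu⟩
  · rintro ⟨c, hc, hu⟩
    exact ⟨labelNode lab (h.sub i hi hc), hu, (h.reachable_of_conn hinj hi (h.sub i hi hc)).1 hc⟩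

lemma sinkSet_toLabeledDirectedTree (h : CutTree W J s t X) (hinj : Set.InjOn lab W)
    (hpart : Setoid.IsPartition (lab '' W)) (hW : W.Nonempty) {i : I} (hi : i ∈ J) :
    (h.toLabeledDirectedTree hinj hpart hW).sinkSet (labelNode lab (h.source_mem i hi))
      (labelNode lab (h.target_mem i hi)) = labelUnion lab (W \ X i) := by
  ext u
  constructor
  · rintro ⟨⟨_, c, hc, rfl⟩, hu, hr⟩
    exact ⟨c, ⟨hc, fun hcX => h.right i hi ((h.mem_cut_of_reachable hinj hi hc _ hr).1 hcX)⟩, hu⟩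
  · rintro ⟨c, hc, hu⟩
    exact ⟨labelNode lab hc.1, hu, (h.reachable_of_conn hinj hi hc.1).2 hc.2⟩

end CutTree

namespace SpineOn

open CutTree

variable {V N I : Type*} {T : SimpleGraph V} {neg : Set V} {W : Set N} {J : Set I}
  {s t : I → N} {X : I → Set N} {lab : N → Set V}

/-- The signed spine described by a tree presented by its cuts whose labels form a partition and
satisfy the spine conditions. -/
def toSignedSpine (h : SpineOn T neg W J s t X lab) (hT : T.IsTree) (hinj : Set.InjOn lab W)
    (hpart : Setoid.IsPartition (lab '' W)) (hW : W.Nonempty) : SignedSpine T neg where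
  toLabeledDirectedTree := h.toCutTree.toLabeledDirectedTree hinj hpart hW
  incoming := by
    set S := h.toCutTree.toLabeledDirectedTree hinj hpart hW with hS
    rintro ⟨_, e, he, rfl⟩
    have key : ∀ A : {A : S.nodes // S.Arc A.1 (lab e)}, ∃ i, ∃ hi : i ∈ J, t i = e ∧
        A.1 = labelNode lab (h.source_mem i hi) ∧
        S.sourceSet A.1 ⟨lab e, e, he, rfl⟩ = labelUnion lab (X i) := by
      rintro ⟨⟨A, hA⟩, i, hi, h1, h2⟩
      simp only at h1
      subst h1
      obtain rfl := hinj (h.target_mem i hi) he h2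
      exact ⟨i, hi, rfl, rfl, h.sourceSet_toLabeledDirectedTree hinj hpart hW hi⟩
    choose i hi hti hA hX using key
    rw [inDistinctComponents_iff hT]
    · simp only [hX]
      refine ⟨fun A u hu v hv w hw => ?_, fun A B hAB u hu v hv => ?_⟩
      · exact h.in_same _ (hi A) u hu v hv w (by rw [hti]; exact hw.1) hw.2
      · obtain ⟨w, hw, hn, hp⟩ := h.in_diff _ (hi A) _ (hi B) (by
          intro hij
          refine hAB (Subtype.ext ?_)
          rw [hA, hA]
          exact Subtype.ext (congrArg (fun i => lab (s i)) hij)) (by rw [hti, hti]) u hu v hv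
        exact ⟨w, ⟨by rwa [hti] at hw, hn⟩, hp⟩
    · intro A
      obtain ⟨u, hu⟩ := S.node_nonempty A.1
      exact ⟨u, A.1, hu, SimpleGraph.Reachable.refl _⟩
    · intro A u hu hU
      rw [hX] at hu
      obtain ⟨c, hc, huc⟩ := hu
      have hcW := h.sub _ (hi A) hc
      have := congrArg Subtype.val
        (S.node_eq (A := ⟨lab c, c, hcW, rfl⟩) (B := ⟨lab e, e, he, rfl⟩) huc hU.1)
      have := hinj hcW he this
      subst this
      exact h.right _ (hi A) (by rwa [hti])
  outgoing := by
    set S := h.toCutTree.toLabeledDirectedTree hinj hpart hW with hS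
    rintro ⟨_, e, he, rfl⟩
    have key : ∀ B : {B : S.nodes // S.Arc (lab e) B.1}, ∃ i, ∃ hi : i ∈ J, s i = e ∧
        B.1 = labelNode lab (h.target_mem i hi) ∧
        S.sinkSet ⟨lab e, e, he, rfl⟩ B.1 = labelUnion lab (W \ X i) := by
      rintro ⟨⟨B, hB⟩, i, hi, h1, h2⟩
      simp only at h2
      subst h2
      obtain rfl := hinj (h.source_mem i hi) he h1
      exact ⟨i, hi, rfl, rfl, h.sinkSet_toLabeledDirectedTree hinj hpart hW hi⟩
    choose i hi hsi hB hX using key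
    rw [inDistinctComponents_iff hT]
    · simp only [hX]
      refine ⟨fun A u hu v hv w hw => ?_, fun A B hAB u hu v hv => ?_⟩
      · exact h.out_same _ (hi A) u hu v hv w (by rw [hsi]; exact hw.1) hw.2
      · obtain ⟨w, hw, hn, hp⟩ := h.out_diff _ (hi A) _ (hi B) (by
          intro hij
          refine hAB (Subtype.ext ?_)
          rw [hB, hB]
          exact Subtype.ext (congrArg (fun i => lab (t i)) hij)) (by rw [hsi, hsi]) u hu v hv
        exact ⟨w, ⟨by rwa [hsi] at hw, hn⟩, hp⟩
    · intro A
      obtain ⟨u, hu⟩ := S.node_nonempty A.1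
      exact ⟨u, A.1, hu, SimpleGraph.Reachable.refl _⟩
    · intro A u hu hU
      rw [hX] at hu
      obtain ⟨c, hc, huc⟩ := hu
      have := congrArg Subtype.val
        (S.node_eq (A := ⟨lab c, c, hc.1, rfl⟩) (B := ⟨lab e, e, he, rfl⟩) huc hU.1)
      have := hinj hc.1 he this
      subst this
      exact hc.2 (by rw [← hsi A]; exact h.left _ (hi A))

end SpineOn

/-! ### Uniqueness of the spine of a point -/

namespace LabeledDirectedTree

variable {V : Type*} (S : LabeledDirectedTree V)

/-- The function `x` is constant on the labels of `S` and increases strictly along its arcs: for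
`x` in the hyperplane, `x` lies in the relative interior of the cone of `S`. -/
def IsStrict (x : V → ℝ) : Prop :=
  (∀ A ∈ S.nodes, ∀ u ∈ A, ∀ v ∈ A, x u = x v) ∧ ∀ A B, S.Arc A B → ∀ u ∈ A, ∀ v ∈ B, x u < x v

/-- The cuts of the arcs of `S`, as sets of vertices. -/
def vertexCuts : Set (Set V) := (fun p => labelUnion Subtype.val (S.cut p)) '' S.arcs

/-- The value of `x` at a chosen element of the label of a node. -/
def nodeValue (x : V → ℝ) (A : S.nodes) : ℝ := x (S.node_nonempty A).some

variable {S}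

lemma IsStrict.nodeValue_eq {x : V → ℝ} (h : S.IsStrict x) {A : S.nodes} {u : V} (hu : u ∈ A.1) :
    S.nodeValue x A = x u :=
  h.1 A.1 A.2 _ (S.node_nonempty A).some_mem _ hu

lemma IsStrict.nodeValue_lt {x : V → ℝ} (h : S.IsStrict x) (p : S.nodes × S.nodes)
    (hp : p ∈ S.arcs) : S.nodeValue x p.1 < S.nodeValue x p.2 :=
  h.2 _ _ hp _ (S.node_nonempty _).some_mem _ (S.node_nonempty _).some_mem

/-- On a path from a node below level `l` to a node not below `l`, some arc crosses this level
upward in the direction of the path. -/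
lemma exists_crossing_arc {f : S.nodes → ℝ} (hf : ∀ p ∈ S.arcs, f p.1 < f p.2) {l : ℝ}
    {A B : S.nodes} (p : S.graph.Walk A B) (hp : p.IsPath) (hA : f A < l) (hB : l ≤ f B) :
    ∃ q ∈ S.arcs, f q.1 < l ∧ l ≤ f q.2 ∧ A ∈ S.cut q ∧ B ∉ S.cut q := by
  induction p with
  | nil => exact absurd hA (not_lt.2 hB)
  | @cons A C B hadj p ih =>
    rw [SimpleGraph.Walk.cons_isPath_iff] at hp
    by_cases hC : f C < l
    · obtain ⟨q, hq, h1, h2, h3, h4⟩ := ih hp.1 hC hB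
      refine ⟨q, hq, h1, h2, ?_, h4⟩
      rcases graph_adj.1 hadj with h | h
      · refine (S.cutTree.cross q hq (A, C) h ?_).2 h3
        rintro rfl
        exact absurd hC (not_lt.2 h2)
      · refine (S.cutTree.cross q hq (C, A) h ?_).1 h3
        rintro rfl
        exact absurd hA (not_lt.2 h2)
    · rcases graph_adj.1 hadj with h | h
      · refine ⟨(A, C), h, hA, not_lt.1 hC, S.cutTree.left _ h, ?_⟩
        rw [notMem_cut_iff h]
        refine (SimpleGraph.Walk.reachable (p.toDeleteEdges {s(A, C)} ?_)).symm
        rintro e he rfl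
        exact hp.2 (p.fst_mem_support_of_mem_edges he)
      · exact absurd (hf (C, A) h) (not_lt.2 (hA.le.trans (not_lt.1 hC)))

/-- Two nodes are equal if no cut separates their labels. -/
lemma node_eq_of_forall_cuts {A B : S.nodes} {u v : V} (hu : u ∈ A.1) (hv : v ∈ B.1)
    (h : ∀ Z ∈ S.vertexCuts, u ∈ Z ↔ v ∈ Z) : A = B := by
  by_contra hne
  have h' : ∀ p ∈ S.arcs, A ∈ S.cut p ↔ B ∈ S.cut p := by
    intro p hp
    have := h _ ⟨p, hp, rfl⟩
    rwa [mem_labelUnion_iff hu, mem_labelUnion_iff hv] at this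
  rcases S.cutTree.branch_cases (p := A) (v := B) trivial trivial (Ne.symm hne) with
    ⟨i, hi, rfl, hB⟩ | ⟨i, hi, rfl, hB⟩
  · exact hB ((h' i hi).1 (S.cutTree.left i hi))
  · exact S.cutTree.right i hi ((h' i hi).2 hB)

/-- The nodes in terms of the vertex cuts: the classes of vertices not separated by a cut. -/
lemma mem_nodes_iff {A : Set V} :
    A ∈ S.nodes ↔ ∃ u, A = {v | ∀ Z ∈ S.vertexCuts, u ∈ Z ↔ v ∈ Z} := by
  have key : ∀ (B : S.nodes) (u : V), u ∈ B.1 → B.1 = {v | ∀ Z ∈ S.vertexCuts, u ∈ Z ↔ v ∈ Z} := by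
    intro B u hu
    ext v
    constructor
    · rintro hv Z ⟨p, hp, rfl⟩
      simp only [mem_labelUnion_iff hu, mem_labelUnion_iff hv]
    · intro h
      obtain ⟨C, hC⟩ := S.exists_node v
      rw [node_eq_of_forall_cuts hu hC h]
      exact hC
  constructor
  · intro hA
    obtain ⟨u, hu⟩ := S.node_nonempty ⟨A, hA⟩
    exact ⟨u, key ⟨A, hA⟩ u hu⟩
  · rintro ⟨u, rfl⟩
    obtain ⟨B, hB⟩ := S.exists_node u
    rw [← key B u hB]
    exact B.2

/-- The arcs in terms of the vertex cuts: exactly one cut separates the two ends of an arc. -/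
lemma arc_iff {A B : Set V} : S.Arc A B ↔ A ∈ S.nodes ∧ B ∈ S.nodes ∧
    ∃ u ∈ A, ∃ v ∈ B, ∃ Z ∈ S.vertexCuts, u ∈ Z ∧ v ∉ Z ∧
      ∀ Z' ∈ S.vertexCuts, Z' ≠ Z → (u ∈ Z' ↔ v ∈ Z') := by
  constructor
  · intro h
    obtain ⟨hA, hB⟩ := S.arc_mem A B h
    obtain ⟨u, hu⟩ := S.node_nonempty ⟨A, hA⟩
    obtain ⟨v, hv⟩ := S.node_nonempty ⟨B, hB⟩
    have hu' := fun Y => mem_labelUnion_iff (A := ⟨A, hA⟩) hu (Y := Y)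
    have hv' := fun Y => mem_labelUnion_iff (A := ⟨B, hB⟩) hv (Y := Y)
    have hp : ((⟨A, hA⟩, ⟨B, hB⟩) : S.nodes × S.nodes) ∈ S.arcs := h
    refine ⟨hA, hB, u, hu, v, hv, _, ⟨_, hp, rfl⟩, ?_, ?_, ?_⟩
    · exact (hu' _).2 (S.cutTree.left _ hp)
    · exact fun h' => S.cutTree.right _ hp ((hv' _).1 h')
    · rintro _ ⟨q, hq, rfl⟩ hne
      have hne' : ((⟨A, hA⟩, ⟨B, hB⟩) : S.nodes × S.nodes) ≠ q := by rintro rfl; exact hne rfl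
      simp only [hu', hv']
      exact S.cutTree.cross q hq _ hp hne'
  · rintro ⟨hA, hB, u, hu, v, hv, _, ⟨p, hp, rfl⟩, huZ, hvZ, hZ⟩
    have hu' := fun Y => mem_labelUnion_iff (A := ⟨A, hA⟩) hu (Y := Y)
    have hv' := fun Y => mem_labelUnion_iff (A := ⟨B, hB⟩) hv (Y := Y)
    simp only [hu', hv'] at huZ hvZ
    have hcut : ∀ q ∈ S.arcs, ¬ ((⟨A, hA⟩ : S.nodes) ∈ S.cut q ↔ (⟨B, hB⟩ : S.nodes) ∈ S.cut q) →
        q = p := by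
      intro q hq hne
      by_contra hqp
      have := hZ _ ⟨q, hq, rfl⟩ (by
        intro heq
        refine hqp (S.cutTree.cut_injective hq hp ?_)
        ext C
        obtain ⟨w, hw⟩ := S.node_nonempty C
        rw [← mem_labelUnion_iff hw, ← mem_labelUnion_iff hw]
        exact iff_of_eq (congrArg (w ∈ ·) heq))
      simp only [hu', hv'] at this
      exact hne this
    have hne : (⟨B, hB⟩ : S.nodes) ≠ ⟨A, hA⟩ := by
      intro h
      rw [h] at hvZ
      exact hvZ huZ
    have h1 : p.1 = ⟨A, hA⟩ := by
      rcases S.cutTree.branch_cases (p := ⟨A, hA⟩) (v := ⟨B, hB⟩) trivial trivial hne with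
        ⟨i, hi, hiA, hiB⟩ | ⟨i, hi, hiA, hiB⟩
      · have := hcut i hi (by rw [← hiA]; exact fun h => hiB (h.1 (S.cutTree.left i hi)))
        rwa [this] at hiA
      · have := hcut i hi (by rw [← hiA]; exact fun h => S.cutTree.right i hi (h.2 hiB))
        rw [this] at hiB
        exact absurd hiB hvZ
    have h2 : p.2 = ⟨B, hB⟩ := by
      rcases S.cutTree.branch_cases (p := ⟨B, hB⟩) (v := ⟨A, hA⟩) trivial trivial hne.symm with
        ⟨i, hi, hiA, hiB⟩ | ⟨i, hi, hiA, hiB⟩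
      · have := hcut i hi (by rw [← hiA]; exact fun h => hiB (h.2 (S.cutTree.left i hi)))
        rw [this] at hiB
        exact absurd huZ hiB
      · have := hcut i hi (by rw [← hiA]; exact fun h => S.cutTree.right i hi (h.1 hiB))
        rwa [this] at hiA
    have hp' : S.Arc p.1.1 p.2.1 := hp
    rwa [h1, h2] at hp'

lemma eq_of_vertexCuts_eq {S' : LabeledDirectedTree V} (h : S.vertexCuts = S'.vertexCuts) :
    S = S' := by
  have hn : S.nodes = S'.nodes := by ext A; rw [mem_nodes_iff, mem_nodes_iff, h]
  refine LabeledDirectedTree.ext hn ?_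
  funext A B
  rw [arc_iff.eq, arc_iff.eq, hn, h]

end LabeledDirectedTree

namespace SignedSpine

open LabeledDirectedTree

variable {V : Type*} [Finite V] {T : SimpleGraph V} {neg : Set V}

lemma levelCut (hT : T.IsTree) (S : SignedSpine T neg) {x : V → ℝ} (hx : S.IsStrict x) {l : ℝ}
    {p : S.nodes × S.nodes} (hp : p ∈ S.arcs) (h₁ : S.nodeValue x p.1 < l)
    (h₂ : l ≤ S.nodeValue x p.2) :
    LevelCut T neg {v | x v < l} (labelUnion Subtype.val (S.cut p)) := by
  refine (S.spineOn hT).levelCut hT (fun v => ?_) ?_ (S.nodeValue x) (hx.nodeValue_lt) hp ?_ h₁ h₂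
  · obtain ⟨A, hA⟩ := S.exists_node v
    exact ⟨A, trivial, hA⟩
  · exact fun A _ B _ v hA hB => node_eq hA hB
  · intro A _ v hv
    rw [hx.nodeValue_eq hv]; rfl

lemma vertexCuts_subset (hT : T.IsTree) {S S' : SignedSpine T neg} {x : V → ℝ}
    (h : S.IsStrict x) (h' : S'.IsStrict x) : S.vertexCuts ⊆ S'.vertexCuts := by
  rintro _ ⟨p, hp, rfl⟩
  have hX := S.levelCut hT h hp (h.nodeValue_lt p hp) le_rfl
  obtain ⟨a₀, ha₀⟩ := S.node_nonempty p.1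
  obtain ⟨b₀, hb₀⟩ := S.node_nonempty p.2
  obtain ⟨a, ha, haD, b, hb, hbD, hab⟩ := hX.exists_base hT (a₀ := a₀) (b₀ := b₀)
    ⟨_, S.cutTree.left p hp, ha₀⟩ (by
      rw [Set.mem_ofPred_eq, ← h.nodeValue_eq ha₀]; exact h.nodeValue_lt p hp)
    (by rw [mem_labelUnion_iff hb₀]; exact S.cutTree.right p hp)
    (by rw [Set.mem_ofPred_eq, ← h.nodeValue_eq hb₀]; exact lt_irrefl _)
  obtain ⟨A, hA⟩ := S'.exists_node a
  obtain ⟨B, hB⟩ := S'.exists_node b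
  obtain ⟨w, hw, -⟩ := S'.isTree.existsUnique_path A B
  obtain ⟨q, hq, h1, h2, h3, h4⟩ := exists_crossing_arc h'.nodeValue_lt w hw
    (l := S.nodeValue x p.2) (by rw [h'.nodeValue_eq hA]; exact haD)
    (by rw [h'.nodeValue_eq hB]; exact not_lt.1 hbD)
  have hY := S'.levelCut hT h' hq h1 h2
  have haY := (mem_labelUnion_iff hA).2 h3
  have hbY := (mem_labelUnion_iff hB (Y := S'.cut q)).not.2 h4
  exact ⟨q, hq, Set.Subset.antisymm (hY.subset_of_base hT hX haY ha haD hbY hb hbD hab)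
    (hX.subset_of_base hT hY ha haY haD hb hbY hbD hab)⟩

/-- A point lies in the relative interior of the cone of at most one signed spine. -/
theorem eq_of_isStrict (hT : T.IsTree) {S S' : SignedSpine T neg} {x : V → ℝ}
    (h : S.IsStrict x) (h' : S'.IsStrict x) : S = S' := by
  have := eq_of_vertexCuts_eq
    (Set.Subset.antisymm (vertexCuts_subset hT h h') (vertexCuts_subset hT h' h))
  cases S; cases S'
  simp only at this
  subst this
  rfl

end SignedSpine

/-! ### Spines of linear orders -/

namespace CutTree

variable {N I : Type*} {W₁ W₂ : Set N} {J₁ J₂ : Set I} {s t : I → N} {X₁ X₂ : I → Set N} {g : N}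

open Classical in
/-- The retraction onto `W` that sends everything else to `g`. -/
def retract (W : Set N) (g c : N) : N := if c ∈ W then c else g

lemma retract_of_mem {W : Set N} {g c : N} (h : c ∈ W) : retract W g c = c := if_pos h

lemma retract_of_notMem {W : Set N} {g c : N} (h : c ∉ W) : retract W g c = g := if_neg h

open Classical in
/-- The cuts of the union of two trees that share the single node `g`. -/
def glueCut (W₁ W₂ : Set N) (J₁ : Set I) (X₁ X₂ : I → Set N) (g : N) (i : I) : Set N :=
  {c | c ∈ W₁ ∪ W₂ ∧ if i ∈ J₁ then retract W₁ g c ∈ X₁ i else retract W₂ g c ∈ X₂ i}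

lemma mem_glueCut_left {i : I} (hi : i ∈ J₁) {c : N} :
    c ∈ glueCut W₁ W₂ J₁ X₁ X₂ g i ↔ c ∈ W₁ ∪ W₂ ∧ retract W₁ g c ∈ X₁ i := by
  simp only [glueCut, hi, if_true, Set.mem_ofPred_eq]

lemma mem_glueCut_right {i : I} (hi : i ∉ J₁) {c : N} :
    c ∈ glueCut W₁ W₂ J₁ X₁ X₂ g i ↔ c ∈ W₁ ∪ W₂ ∧ retract W₂ g c ∈ X₂ i := by
  simp only [glueCut, hi, if_false, Set.mem_ofPred_eq]

lemma arcs_disjoint (h₁ : CutTree W₁ J₁ s t X₁) (h₂ : CutTree W₂ J₂ s t X₂)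
    (hg : W₁ ∩ W₂ = {g}) {i : I} (hi : i ∈ J₂) : i ∉ J₁ := by
  intro hi₁
  have hs : s i ∈ W₁ ∩ W₂ := ⟨h₁.source_mem i hi₁, h₂.source_mem i hi⟩
  have ht : t i ∈ W₁ ∩ W₂ := ⟨h₁.target_mem i hi₁, h₂.target_mem i hi⟩
  rw [hg, Set.mem_singleton_iff] at hs ht
  exact h₁.right i hi₁ (ht.trans hs.symm ▸ h₁.left i hi₁)

lemma retract_of_mem_other (hg : W₁ ∩ W₂ = {g}) {c : N} (hc : c ∈ W₂) : retract W₁ g c = g := by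
  by_cases h : c ∈ W₁
  · rw [retract_of_mem h]
    have : c ∈ W₁ ∩ W₂ := ⟨h, hc⟩
    rwa [hg] at this
  · exact retract_of_notMem h

/-- The union of two trees that share a single node. -/
lemma glue (h₁ : CutTree W₁ J₁ s t X₁) (h₂ : CutTree W₂ J₂ s t X₂) (hg : W₁ ∩ W₂ = {g}) :
    CutTree (W₁ ∪ W₂) (J₁ ∪ J₂) s t (glueCut W₁ W₂ J₁ X₁ X₂ g) := by
  have hJ : ∀ i ∈ J₂, i ∉ J₁ := fun i hi => h₁.arcs_disjoint h₂ hg hi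
  have hg' : W₂ ∩ W₁ = {g} := by rwa [Set.inter_comm]
  have hgm : g ∈ W₁ ∩ W₂ := hg ▸ rfl
  constructor
  · rintro i (hi | hi)
    · exact Or.inl (h₁.source_mem i hi)
    · exact Or.inr (h₂.source_mem i hi)
  · rintro i (hi | hi)
    · exact Or.inl (h₁.target_mem i hi)
    · exact Or.inr (h₂.target_mem i hi)
  · rintro i - c hc
    exact hc.1
  · rintro i (hi | hi)
    · rw [mem_glueCut_left hi, retract_of_mem (h₁.source_mem i hi)]
      exact ⟨Or.inl (h₁.source_mem i hi), h₁.left i hi⟩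
    · rw [mem_glueCut_right (hJ i hi), retract_of_mem (h₂.source_mem i hi)]
      exact ⟨Or.inr (h₂.source_mem i hi), h₂.left i hi⟩
  · rintro i (hi | hi)
    · rw [mem_glueCut_left hi, retract_of_mem (h₁.target_mem i hi)]
      exact fun h => h₁.right i hi h.2
    · rw [mem_glueCut_right (hJ i hi), retract_of_mem (h₂.target_mem i hi)]
      exact fun h => h₂.right i hi h.2
  · rintro i (hi | hi) j (hj | hj) hne
    · rw [mem_glueCut_left hi, mem_glueCut_left hi, retract_of_mem (h₁.source_mem j hj),
        retract_of_mem (h₁.target_mem j hj), h₁.cross i hi j hj hne]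
      simp [h₁.source_mem j hj, h₁.target_mem j hj]
    · rw [mem_glueCut_left hi, mem_glueCut_left hi, retract_of_mem_other hg (h₂.source_mem j hj),
        retract_of_mem_other hg (h₂.target_mem j hj)]
      simp [h₂.source_mem j hj, h₂.target_mem j hj]
    · rw [mem_glueCut_right (hJ i hi), mem_glueCut_right (hJ i hi),
        retract_of_mem_other hg' (h₁.source_mem j hj),
        retract_of_mem_other hg' (h₁.target_mem j hj)]
      simp [h₁.source_mem j hj, h₁.target_mem j hj]
    · rw [mem_glueCut_right (hJ i hi), mem_glueCut_right (hJ i hi),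
        retract_of_mem (h₂.source_mem j hj),
        retract_of_mem (h₂.target_mem j hj), h₂.cross i hi j hj hne]
      simp [h₂.source_mem j hj, h₂.target_mem j hj]
  · intro P hP
    have hP₁ := h₁.conn P fun i hi => hP i (Or.inl hi)
    have hP₂ := h₂.conn P fun i hi => hP i (Or.inr hi)
    rintro a (ha | ha) b (hb | hb) hPa
    · exact hP₁ a ha b hb hPa
    · exact hP₂ g hgm.2 b hb (hP₁ a ha g hgm.1 hPa)
    · exact hP₁ g hgm.1 b hb (hP₂ a ha g hgm.2 hPa)
    · exact hP₂ a ha b hb hPa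

/-- The tree with the two nodes `a` and `b` and the single arc `i` from `a` to `b`. -/
lemma singleArc {i : I} (h : s i ≠ t i) : CutTree {s i, t i} {i} s t (fun _ => {s i}) := by
  constructor
  · rintro _ rfl; simp
  · rintro _ rfl; simp
  · intro _ _; simp
  · rintro _ rfl; simp
  · rintro _ rfl; simpa using h.symm
  · rintro _ rfl _ rfl h; exact absurd rfl h
  · intro P hP
    have := hP i rfl
    rintro a (rfl | rfl) b (rfl | rfl) <;> simp [this]

end CutTree

open CutTree

variable {V : Type*} {T : SimpleGraph V} {neg : Set V}

/-- A spine on the vertex set `W` all of whose labels are singletons, with arcs `J` and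
cuts `X`. -/
abbrev VertexSpine (T : SimpleGraph V) (neg W : Set V) (J : Set (V × V)) (X : V × V → Set V) :
    Prop :=
  SpineOn T neg W J Prod.fst Prod.snd X (fun v => ({v} : Set V))

namespace VertexSpine

variable {W W₁ W₂ : Set V} {J J₁ J₂ : Set (V × V)} {X X₁ X₂ : V × V → Set V}

lemma mk' (h : CutTree W J Prod.fst Prod.snd X)
    (h₁ : ∀ i ∈ J, ∀ u ∈ X i, ∀ v ∈ X i, i.2 ∈ neg → ¬ OnPath T u v i.2)
    (h₂ : ∀ i ∈ J, ∀ j ∈ J, i ≠ j → i.2 = j.2 → ∀ u ∈ X i, ∀ v ∈ X j,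
      i.2 ∈ neg ∧ OnPath T u v i.2)
    (h₃ : ∀ i ∈ J, ∀ u ∈ W \ X i, ∀ v ∈ W \ X i, i.1 ∉ neg → ¬ OnPath T u v i.1)
    (h₄ : ∀ i ∈ J, ∀ j ∈ J, i ≠ j → i.1 = j.1 → ∀ u ∈ W \ X i, ∀ v ∈ W \ X j,
      i.1 ∉ neg ∧ OnPath T u v i.1) : VertexSpine T neg W J X := by
  refine ⟨h, ?_, ?_, ?_, ?_⟩ <;> simp only [labelUnion_singleton]
  · rintro i hi u hu v hv _ rfl
    exact h₁ i hi u hu v hv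
  · intro i hi j hj hne hij u hu v hv
    exact ⟨_, rfl, h₂ i hi j hj hne hij u hu v hv⟩
  · rintro i hi u hu v hv _ rfl
    exact h₃ i hi u hu v hv
  · intro i hi j hj hne hij u hu v hv
    exact ⟨_, rfl, h₄ i hi j hj hne hij u hu v hv⟩

lemma not_onPath_target (h : VertexSpine T neg W J X) {i : V × V} (hi : i ∈ J) {u v : V}
    (hu : u ∈ X i) (hv : v ∈ X i) (hn : i.2 ∈ neg) : ¬ OnPath T u v i.2 :=
  h.in_same i hi u (by simpa using hu) v (by simpa using hv) _ rfl hn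

lemma onPath_target (h : VertexSpine T neg W J X) {i j : V × V} (hi : i ∈ J) (hj : j ∈ J)
    (hne : i ≠ j) (hij : i.2 = j.2) {u v : V} (hu : u ∈ X i) (hv : v ∈ X j) :
    i.2 ∈ neg ∧ OnPath T u v i.2 := by
  obtain ⟨w, rfl, hw⟩ :=
    h.in_diff i hi j hj hne hij u (by simpa using hu) v (by simpa using hv)
  exact hw

lemma not_onPath_source (h : VertexSpine T neg W J X) {i : V × V} (hi : i ∈ J) {u v : V}
    (hu : u ∈ W \ X i) (hv : v ∈ W \ X i) (hn : i.1 ∉ neg) : ¬ OnPath T u v i.1 :=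
  h.out_same i hi u (by simpa using hu) v (by simpa using hv) _ rfl hn

lemma onPath_source (h : VertexSpine T neg W J X) {i j : V × V} (hi : i ∈ J) (hj : j ∈ J)
    (hne : i ≠ j) (hij : i.1 = j.1) {u v : V} (hu : u ∈ W \ X i) (hv : v ∈ W \ X j) :
    i.1 ∉ neg ∧ OnPath T u v i.1 := by
  obtain ⟨w, rfl, hw⟩ :=
    h.out_diff i hi j hj hne hij u (by simpa using hu) v (by simpa using hv)
  exact hw

/-- The spine conditions for the cuts obtained by adding to every vertex `ρ c` of a spine the
vertex `c`, provided that `c` and `ρ c` are not separated where this matters. -/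
lemma pullback (h : VertexSpine T neg W₁ J₁ X₁) {ρ : V → V} (hρ : ∀ c ∈ W, ρ c ∈ W₁)
    (ht : ∀ i ∈ J₁, ∀ c ∈ W, ρ c ∈ X₁ i → i.2 ∈ neg → ¬ OnPath T c (ρ c) i.2)
    (hs : ∀ i ∈ J₁, ∀ c ∈ W, ρ c ∉ X₁ i → i.1 ∉ neg → ¬ OnPath T c (ρ c) i.1) :
    (∀ i ∈ J₁, ∀ u ∈ W, ∀ v ∈ W, ρ u ∈ X₁ i → ρ v ∈ X₁ i → i.2 ∈ neg → ¬ OnPath T u v i.2) ∧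
    (∀ i ∈ J₁, ∀ j ∈ J₁, i ≠ j → i.2 = j.2 → ∀ u ∈ W, ∀ v ∈ W, ρ u ∈ X₁ i → ρ v ∈ X₁ j →
      i.2 ∈ neg ∧ OnPath T u v i.2) ∧
    (∀ i ∈ J₁, ∀ u ∈ W, ∀ v ∈ W, ρ u ∉ X₁ i → ρ v ∉ X₁ i → i.1 ∉ neg → ¬ OnPath T u v i.1) ∧
    (∀ i ∈ J₁, ∀ j ∈ J₁, i ≠ j → i.1 = j.1 → ∀ u ∈ W, ∀ v ∈ W, ρ u ∉ X₁ i → ρ v ∉ X₁ j →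
      i.1 ∉ neg ∧ OnPath T u v i.1) := by
  have same : ∀ u v w, ¬ OnPath T u (ρ u) w → ¬ OnPath T v (ρ v) w → ¬ OnPath T (ρ u) (ρ v) w →
      ¬ OnPath T u v w := by
    intro u v w hu hv huv hp
    rcases hp.split (ρ u) with hp | hp
    · exact hu hp
    · rcases hp.split (ρ v) with hp | hp
      · exact huv hp
      · exact hv hp.symm
  have diff : ∀ u v w, ¬ OnPath T u (ρ u) w → ¬ OnPath T v (ρ v) w → OnPath T (ρ u) (ρ v) w →
      OnPath T u v w := by
    intro u v w hu hv hp
    rcases hp.split u with hp | hp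
    · exact absurd hp.symm hu
    · rcases hp.split v with hp | hp
      · exact hp
      · exact absurd hp hv
  refine ⟨?_, ?_, ?_, ?_⟩
  · intro i hi u hu v hv hu' hv' hn
    exact same u v _ (ht i hi u hu hu' hn) (ht i hi v hv hv' hn) (h.not_onPath_target hi hu' hv' hn)
  · intro i hi j hj hne hij u hu v hv hu' hv'
    obtain ⟨hn, hp⟩ := h.onPath_target hi hj hne hij hu' hv'
    refine ⟨hn, diff u v _ (ht i hi u hu hu' hn) ?_ hp⟩
    rw [hij] at hn ⊢
    exact ht j hj v hv hv' hn
  · intro i hi u hu v hv hu' hv' hn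
    exact same u v _ (hs i hi u hu hu' hn) (hs i hi v hv hv' hn)
      (h.not_onPath_source hi ⟨hρ u hu, hu'⟩ ⟨hρ v hv, hv'⟩ hn)
  · intro i hi j hj hne hij u hu v hv hu' hv'
    obtain ⟨hn, hp⟩ := h.onPath_source hi hj hne hij ⟨hρ u hu, hu'⟩ ⟨hρ v hv, hv'⟩
    refine ⟨hn, diff u v _ (hs i hi u hu hu' hn) ?_ hp⟩
    rw [hij] at hn ⊢
    exact hs j hj v hv hv' hn

lemma retract_mem (hW : W₁ ∩ W₂ = {g}) (c : V) : retract W₁ g c ∈ W₁ := by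
  by_cases hc : c ∈ W₁
  · rwa [retract_of_mem hc]
  · rw [retract_of_notMem hc]
    exact (hW ▸ rfl : g ∈ W₁ ∩ W₂).1

lemma not_onPath_retract (hT : T.IsTree)
    (hsep : ∀ a ∈ W₁, ∀ b ∈ W₂, OnPath T a b g) {c w : V} (hc : c ∈ W₁ ∪ W₂) (hw : w ∈ W₁)
    (hne : w ≠ retract W₁ g c) : ¬ OnPath T c (retract W₁ g c) w := by
  intro hp
  by_cases hcW : c ∈ W₁
  · rw [retract_of_mem hcW] at hp hne
    exact hne hp.eq_of_self
  · rw [retract_of_notMem hcW] at hp hne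
    exact hne (OnPath.antisymm hT hp (hsep w hw c (hc.resolve_left hcW)).symm).symm

/-- Two spines on vertex sets that are separated by a common negative vertex `m` can be glued if
`m` is not the source of an arc. -/
lemma glue (hT : T.IsTree) (h₁ : VertexSpine T neg W₁ J₁ X₁) (h₂ : VertexSpine T neg W₂ J₂ X₂)
    {m : V} (hW : W₁ ∩ W₂ = {m}) (hm : m ∈ neg) (hsep : ∀ a ∈ W₁, ∀ b ∈ W₂, OnPath T a b m)
    (hs : ∀ i ∈ J₁, i.1 ≠ m) :
    VertexSpine T neg (W₁ ∪ W₂) (J₁ ∪ J₂) (glueCut W₁ W₂ J₁ X₁ X₂ m) := by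
  have hJ : ∀ i ∈ J₂, i ∉ J₁ := fun i hi => h₁.arcs_disjoint h₂.toCutTree hW hi
  have hW' : W₂ ∩ W₁ = {m} := by rwa [Set.inter_comm]
  have hsep' : ∀ a ∈ W₂, ∀ b ∈ W₁, OnPath T a b m := fun a ha b hb => (hsep b hb a ha).symm
  have hne : ∀ {i c d} {Y : V × V → Set V}, c ∉ Y i → d ∈ Y i → c ≠ d := by
    rintro i c d Y hc hd rfl; exact hc hd
  obtain ⟨a1, a2, a3, a4⟩ := h₁.pullback (W := W₁ ∪ W₂) (ρ := retract W₁ m)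
    (fun c _ => retract_mem hW c)
    (fun i hi c hc hcX _ => not_onPath_retract hT hsep hc (h₁.target_mem i hi)
      (hne (h₁.right i hi) hcX))
    (fun i hi c hc hcX _ => not_onPath_retract hT hsep hc (h₁.source_mem i hi)
      (hne hcX (h₁.left i hi)).symm)
  obtain ⟨b1, b2, b3, b4⟩ := h₂.pullback (W := W₁ ∪ W₂) (ρ := retract W₂ m)
    (fun c _ => retract_mem hW' c)
    (fun i hi c hc hcX _ => not_onPath_retract hT hsep' hc.symm (h₂.target_mem i hi)
      (hne (h₂.right i hi) hcX))
    (fun i hi c hc hcX _ => not_onPath_retract hT hsep' hc.symm (h₂.source_mem i hi)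
      (hne hcX (h₂.left i hi)).symm)
  -- an arc of each part with a common target: this target is `m`
  have hmix : ∀ i ∈ J₁, ∀ j ∈ J₂, i.2 = j.2 → ∀ u ∈ W₁ ∪ W₂, ∀ v ∈ W₁ ∪ W₂,
      retract W₁ m u ∈ X₁ i → retract W₂ m v ∈ X₂ j → i.2 = m ∧ OnPath T u v m := by
    intro i hi j hj hij u hu v hv huX hvX
    have h1 : i.2 ∈ W₁ ∩ W₂ := ⟨h₁.target_mem i hi, hij ▸ h₂.target_mem j hj⟩
    rw [hW, Set.mem_singleton_iff] at h1
    have hu' : u ∈ W₁ := by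
      by_contra hu'
      rw [retract_of_notMem hu', ← h1] at huX
      exact h₁.right i hi huX
    have hv' : v ∈ W₂ := by
      by_contra hv'
      rw [retract_of_notMem hv', ← h1, hij] at hvX
      exact h₂.right j hj hvX
    exact ⟨h1, hsep u hu' v hv'⟩
  have hmix' : ∀ i ∈ J₁, ∀ j ∈ J₂, i.1 ≠ j.1 := by
    intro i hi j hj hij
    have h1 : i.1 ∈ W₁ ∩ W₂ := ⟨h₁.source_mem i hi, hij ▸ h₂.source_mem j hj⟩
    rw [hW, Set.mem_singleton_iff] at h1
    exact hs i hi h1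
  refine mk' (h₁.toCutTree.glue h₂.toCutTree hW) ?_ ?_ ?_ ?_
  · rintro i (hi | hi) u hu v hv hn
    · rw [mem_glueCut_left hi] at hu hv
      exact a1 i hi u hu.1 v hv.1 hu.2 hv.2 hn
    · rw [mem_glueCut_right (hJ i hi)] at hu hv
      exact b1 i hi u hu.1 v hv.1 hu.2 hv.2 hn
  · rintro i (hi | hi) j (hj | hj) hne hij u hu v hv
    · rw [mem_glueCut_left hi] at hu
      rw [mem_glueCut_left hj] at hv
      exact a2 i hi j hj hne hij u hu.1 v hv.1 hu.2 hv.2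
    · rw [mem_glueCut_left hi] at hu
      rw [mem_glueCut_right (hJ j hj)] at hv
      obtain ⟨h1, h2⟩ := hmix i hi j hj hij u hu.1 v hv.1 hu.2 hv.2
      exact h1 ▸ ⟨hm, h2⟩
    · rw [mem_glueCut_right (hJ i hi)] at hu
      rw [mem_glueCut_left hj] at hv
      obtain ⟨h1, h2⟩ := hmix j hj i hi hij.symm v hv.1 u hu.1 hv.2 hu.2
      exact hij.trans h1 ▸ ⟨hm, h2.symm⟩
    · rw [mem_glueCut_right (hJ i hi)] at hu
      rw [mem_glueCut_right (hJ j hj)] at hv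
      exact b2 i hi j hj hne hij u hu.1 v hv.1 hu.2 hv.2
  · rintro i (hi | hi) u hu v hv hn
    · rw [Set.mem_sdiff, mem_glueCut_left hi, not_and] at hu hv
      exact a3 i hi u hu.1 v hv.1 (hu.2 hu.1) (hv.2 hv.1) hn
    · rw [Set.mem_sdiff, mem_glueCut_right (hJ i hi), not_and] at hu hv
      exact b3 i hi u hu.1 v hv.1 (hu.2 hu.1) (hv.2 hv.1) hn
  · rintro i (hi | hi) j (hj | hj) hne hij u hu v hv
    · rw [Set.mem_sdiff, mem_glueCut_left hi, not_and] at hu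
      rw [Set.mem_sdiff, mem_glueCut_left hj, not_and] at hv
      exact a4 i hi j hj hne hij u hu.1 v hv.1 (hu.2 hu.1) (hv.2 hv.1)
    · exact absurd hij (hmix' i hi j hj)
    · exact absurd hij.symm (hmix' j hj i hi)
    · rw [Set.mem_sdiff, mem_glueCut_right (hJ i hi), not_and] at hu
      rw [Set.mem_sdiff, mem_glueCut_right (hJ j hj), not_and] at hv
      exact b4 i hi j hj hne hij u hu.1 v hv.1 (hu.2 hu.1) (hv.2 hv.1)

/-- Attaching a new vertex `m` as a leaf above the vertex `a` of a spine. -/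
lemma insert (h : VertexSpine T neg W J X) {m a : V} (hm : m ∉ W) (ha : a ∈ W)
    (hmneg : m ∈ neg → ∀ c ∈ W, ∀ d ∈ W, ¬ OnPath T c d m)
    (ht : ∀ i ∈ J, a ∈ X i → i.2 ∈ neg → ¬ OnPath T m a i.2)
    (hs : ∀ i ∈ J, a ∉ X i → i.1 ∉ neg → ¬ OnPath T m a i.1)
    (hsa : ∀ i ∈ J, i.1 = a → a ∉ neg ∧ ∀ d ∈ W \ X i, OnPath T m d a) :
    ∃ Y, VertexSpine T neg (W ∪ {a, m}) (J ∪ {(a, m)}) Y := by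
  have ham : a ≠ m := by rintro rfl; exact hm ha
  have hW : W ∩ {a, m} = {a} := by
    ext c
    simp only [Set.mem_inter_iff, Set.mem_insert_iff, Set.mem_singleton_iff]
    constructor
    · rintro ⟨hc, rfl | rfl⟩
      · rfl
      · exact absurd hc hm
    · rintro rfl; exact ⟨ha, Or.inl rfl⟩
  have htree := singleArc (s := Prod.fst) (t := Prod.snd) (i := (a, m)) ham
  have hJ : (a, m) ∉ J := h.arcs_disjoint htree hW rfl
  have hmem : ∀ c, c ∈ W ∪ {a, m} ↔ c ∈ W ∨ c = m := by
    intro c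
    simp only [Set.mem_union, Set.mem_insert_iff, Set.mem_singleton_iff]
    constructor
    · rintro (hc | rfl | hc)
      · exact Or.inl hc
      · exact Or.inl ha
      · exact Or.inr hc
    · rintro (hc | hc)
      · exact Or.inl hc
      · exact Or.inr (Or.inr hc)
  have hrm : retract W a m = a := retract_of_notMem hm
  have hnew : ∀ c, c ∈ glueCut W {a, m} J X (fun _ => {a}) a (a, m) ↔ c ∈ W := by
    intro c
    rw [mem_glueCut_right hJ, hmem]
    constructor
    · rintro ⟨hc | rfl, hr⟩
      · exact hc
      · rw [retract_of_mem (by simp), Set.mem_singleton_iff] at hr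
        exact absurd hr.symm ham
    · intro hc
      exact ⟨Or.inl hc, retract_of_mem_other (by rwa [Set.inter_comm]) hc⟩
  have hnew' : ∀ c, c ∈ (W ∪ {a, m}) \ glueCut W {a, m} J X (fun _ => {a}) a (a, m) → c = m := by
    intro c hc
    rw [Set.mem_sdiff, hnew, hmem] at hc
    exact hc.1.resolve_left hc.2
  obtain ⟨a1, a2, a3, a4⟩ := h.pullback (W := W ∪ {a, m}) (ρ := retract W a)
    (fun c _ => retract_mem hW c)
    (by
      intro i hi c hc hcX hn
      rcases (hmem c).1 hc with hc | rfl
      · rw [retract_of_mem hc] at hcX ⊢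
        exact fun hp => h.right i hi (hp.eq_of_self ▸ hcX)
      · rw [hrm] at hcX ⊢
        exact ht i hi hcX hn)
    (by
      intro i hi c hc hcX hn
      rcases (hmem c).1 hc with hc | rfl
      · rw [retract_of_mem hc] at hcX ⊢
        exact fun hp => hcX (hp.eq_of_self ▸ h.left i hi)
      · rw [hrm] at hcX ⊢
        exact hs i hi hcX hn)
  have hmt : ∀ i ∈ J, i.2 ≠ m := by rintro i hi rfl; exact hm (h.target_mem i hi)
  -- an old arc out of `a` and the new arc
  have hmix : ∀ i ∈ J, i.1 = a → ∀ u ∈ W ∪ {a, m}, retract W a u ∉ X i →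
      a ∉ neg ∧ OnPath T m u a := by
    intro i hi hia u hu huX
    rcases (hmem u).1 hu with hu | rfl
    · rw [retract_of_mem hu] at huX
      exact ⟨(hsa i hi hia).1, (hsa i hi hia).2 u ⟨hu, huX⟩⟩
    · rw [hrm] at huX
      exact absurd (hia ▸ h.left i hi) huX
  refine ⟨_, mk' (h.toCutTree.glue htree hW) ?_ ?_ ?_ ?_⟩
  · rintro i (hi | rfl) u hu v hv hn
    · rw [mem_glueCut_left hi] at hu hv
      exact a1 i hi u hu.1 v hv.1 hu.2 hv.2 hn
    · rw [hnew] at hu hv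
      exact hmneg hn u hu v hv
  · rintro i (hi | rfl) j (hj | rfl) hne hij u hu v hv
    · rw [mem_glueCut_left hi] at hu
      rw [mem_glueCut_left hj] at hv
      exact a2 i hi j hj hne hij u hu.1 v hv.1 hu.2 hv.2
    · exact absurd hij (hmt i hi)
    · exact absurd hij.symm (hmt j hj)
    · exact absurd rfl hne
  · rintro i (hi | rfl) u hu v hv hn
    · rw [Set.mem_sdiff, mem_glueCut_left hi, not_and] at hu hv
      exact a3 i hi u hu.1 v hv.1 (hu.2 hu.1) (hv.2 hv.1) hn
    · rw [hnew' u hu, hnew' v hv]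
      exact fun hp => ham hp.eq_of_self
  · rintro i (hi | rfl) j (hj | rfl) hne hij u hu v hv
    · rw [Set.mem_sdiff, mem_glueCut_left hi, not_and] at hu
      rw [Set.mem_sdiff, mem_glueCut_left hj, not_and] at hv
      exact a4 i hi j hj hne hij u hu.1 v hv.1 (hu.2 hu.1) (hv.2 hv.1)
    · rw [Set.mem_sdiff, mem_glueCut_left hi, not_and] at hu
      obtain ⟨h1, h2⟩ := hmix i hi hij u hu.1 (hu.2 hu.1)
      rw [hnew' v hv, show i.1 = a from hij]
      exact ⟨h1, h2.symm⟩
    · rw [Set.mem_sdiff, mem_glueCut_left hj, not_and] at hv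
      rw [hnew' u hu]
      exact hmix j hj hij.symm v hv.1 (hv.2 hv.1)
    · exact absurd rfl hne

end VertexSpine

namespace VertexSpine

variable {V : Type*} {T : SimpleGraph V} {neg : Set V} [Finite V] [LinearOrder V]
  {W : Set V} {J : Set (V × V)} {X : V × V → Set V} {m a : V}

/-- No positive vertex of `W` other than `a` itself lies on the path from `a` to `m`. -/
def Visible (T : SimpleGraph V) (neg W : Set V) (m a : V) : Prop :=
  ∀ v ∈ W, v ∉ neg → v ≠ a → ¬ OnPath T a m v

/-- The highest visible vertex `a` may receive the new leaf `m` on the source side of an arc `i`, as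
the target of `i` does not separate it from `m`: otherwise this target is visible as well, hence
lower than `a`, and the spine turns upward on the way from `i` to `a` at a positive vertex that
hides `a`. -/
lemma not_onPath_of_mem_cut (hT : T.IsTree) (h : VertexSpine T neg W J X)
    (hJ : ∀ i ∈ J, i.1 < i.2) (ha : Visible T neg W m a)
    (hmax : ∀ u ∈ W, Visible T neg W m u → u ≤ a) {i : V × V} (hi : i ∈ J) (hai : a ∈ X i) :
    ¬ OnPath T m a i.2 := by
  intro hp
  have hne : i.2 ≠ a := by rintro rfl; exact h.right i hi hai
  have hvis : Visible T neg W m i.2 := by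
    intro v hv hn hvi hpv
    refine ha v hv hn ?_ (hp.symm.trans_right hT hpv)
    rintro rfl
    exact hne (OnPath.antisymm hT hp hpv.symm).symm
  have hlt : i.2 < a := lt_of_le_of_ne (hmax _ (h.target_mem i hi) hvis) hne
  rcases h.descend_or_turn id hJ hi hai with ⟨h1, -⟩ | ⟨k, hk, -, -, h3, h4, -⟩
  · exact absurd (hJ i hi) (not_lt.2 (hlt.le.trans h1))
  · have haW := h.sub i hi hai
    simp only [labelUnion_singleton] at h4
    obtain ⟨_, rfl, hn, hpk⟩ := h4 a ⟨haW, h3⟩ i.2 ⟨h.target_mem i hi, h.right i hi⟩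
    refine ha k.1 (h.source_mem k hk) hn ?_ (hp.symm.trans_left hT hpk)
    rintro rfl
    exact h3 (h.left k hk)

/-- If the highest visible vertex `a` is the source of an arc, then it is positive and separates
what lies beyond this arc from `m`. Indeed, the target of the arc is higher than `a`, hence hidden
by a positive vertex, and the hiding vertex closest to `m` turns out to be `a`. -/
lemma onPath_of_source_eq (hT : T.IsTree) (h : VertexSpine T neg W J X)
    (hJ : ∀ i ∈ J, i.1 < i.2) (haW : a ∈ W) (ha : Visible T neg W m a)
    (hmax : ∀ u ∈ W, Visible T neg W m u → u ≤ a) {i : V × V} (hi : i ∈ J) (hia : i.1 = a) :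
    a ∉ neg ∧ ∀ d ∈ W \ X i, OnPath T m d a := by
  subst hia
  have hne : ({y | y ∈ W ∧ y ∉ neg ∧ y ≠ i.2 ∧ OnPath T i.2 m y}).Nonempty := by
    by_contra hc
    rw [Set.not_nonempty_iff_eq_empty] at hc
    have hvis : Visible T neg W m i.2 := fun v hv hn hvi hp =>
      (hc ▸ (⟨hv, hn, hvi, hp⟩ : v ∈ {y | y ∈ W ∧ y ∉ neg ∧ y ≠ i.2 ∧ OnPath T i.2 m y}) :
        v ∈ (∅ : Set V))
    exact absurd (hJ i hi) (not_lt.2 (hmax _ (h.target_mem i hi) hvis))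
  -- the positive vertex `y` closest to `m` that hides the target of `i` is the source of `i`
  obtain ⟨y, ⟨hyW, hyn, hyi, hyp⟩, hmin⟩ :=
    Set.exists_min_image _ (fun y => T.dist m y) (Set.toFinite _) hne
  have hy : y = i.1 := by
    by_contra hya
    have hvis : Visible T neg W m y := by
      intro v hv hn hvy hp
      have hvi : v ≠ i.2 := by
        rintro rfl
        exact hvy (OnPath.antisymm hT hyp.symm hp.symm)
      exact absurd (hmin v ⟨hv, hn, hvi, hyp.trans_right hT hp⟩)
        (not_le.2 (hp.symm.dist_lt hT hvy))
    have hlt : y < i.1 := lt_of_le_of_ne (hmax y hyW hvis) hya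
    have hp : OnPath T i.2 i.1 y := (hyp.split i.1).resolve_right (ha y hyW hyn hya)
    have hside : ∀ k ∈ J, k.1 ≠ i.1 → i.1 ∉ X k → i.2 ∈ W \ X k := by
      intro k hk hki hiX
      refine ⟨h.target_mem i hi, ?_⟩
      rwa [← h.cross k hk i hi]
      rintro rfl
      exact hki rfl
    rcases h.branch_cases hyW haW hlt.ne' with ⟨k, hk, rfl, hak⟩ | ⟨k, hk, rfl, hak⟩
    · exact h.not_onPath_source hk (hside k hk hya hak) ⟨haW, hak⟩ hyn hp
    · rcases h.descend_or_turn id hJ hk hak with ⟨h1, -⟩ | ⟨l, hl, -, -, h3, h4, -⟩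
      · exact absurd (hJ k hk) (not_lt.2 (hlt.le.trans h1))
      · simp only [labelUnion_singleton] at h4
        obtain ⟨_, rfl, hn, hpl⟩ := h4 i.1 ⟨haW, h3⟩ k.2 ⟨hyW, h.right k hk⟩
        refine h.not_onPath_source hl ⟨haW, h3⟩ (hside l hl ?_ h3) hn (hp.symm.trans_left hT hpl)
        intro heq
        exact h3 (heq ▸ h.left l hl)
  subst hy
  refine ⟨hyn, fun d hd => (hyp.symm.split d).resolve_right fun hp => ?_⟩
  exact h.not_onPath_source hi hd ⟨h.target_mem i hi, h.right i hi⟩ hyn hp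

/-- Every subset of the vertices of a tree carries a spine compatible with a given linear order.
The maximal vertex `m` of the subset is added last. If `m` is negative and separates the other
vertices, the spines of two sides are glued at `m`; otherwise `m` becomes a leaf above the
highest vertex that is not hidden from it by a positive vertex. -/
theorem exists_increasing (hT : T.IsTree) (neg W : Set V) :
    ∃ J X, VertexSpine T neg W J X ∧ ∀ i ∈ J, i.1 < i.2 := by
  induction hn : W.ncard using Nat.strong_induction_on generalizing W with
  | h n ih =>
  subst hn
  have small : W.Subsingleton → ∃ J X, VertexSpine T neg W J X ∧ ∀ i ∈ J, i.1 < i.2 := by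
    intro hW
    refine ⟨∅, fun _ => ∅, mk' ⟨?_, ?_, ?_, ?_, ?_, ?_, ?_⟩ ?_ ?_ ?_ ?_, ?_⟩
    case refine_7 =>
      intro P _ a ha b hb hPa
      exact hW ha hb ▸ hPa
    all_goals exact fun i hi => absurd hi (Set.notMem_empty i)
  by_cases hW : W.Subsingleton
  · exact small hW
  have hWne : W.Nonempty := by
    rw [Set.nonempty_iff_ne_empty]; rintro rfl; exact hW Set.subsingleton_empty
  obtain ⟨m, hm, hmax⟩ := Set.exists_max_image W id (Set.toFinite _) hWne
  have hss : ∀ W' : Set V, W' ⊂ W → W'.ncard < W.ncard := fun W' h =>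
    Set.ncard_lt_ncard h (Set.toFinite _)
  by_cases hsplit : m ∈ neg ∧ ∃ u ∈ W, u ≠ m ∧ ∃ v ∈ W, v ≠ m ∧ OnPath T u v m
  · obtain ⟨hmn, u, hu, hum, v, hv, hvm, hp⟩ := hsplit
    set W₁ : Set V := {w ∈ W | w = m ∨ ¬ OnPath T u w m} with hW₁
    set W₂ : Set V := {w ∈ W | OnPath T u w m} with hW₂
    have hlt₁ : W₁ ⊂ W := by
      refine ⟨fun w hw => hw.1, fun h => ?_⟩
      rcases (h hv).2 with h | h
      · exact hvm h
      · exact h hp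
    have hlt₂ : W₂ ⊂ W := by
      refine ⟨fun w hw => hw.1, fun h => ?_⟩
      exact hum ((h hu).2.eq_of_self).symm
    obtain ⟨J₁, X₁, h₁, hJ₁⟩ := ih _ (hss _ hlt₁) W₁ rfl
    obtain ⟨J₂, X₂, h₂, hJ₂⟩ := ih _ (hss _ hlt₂) W₂ rfl
    have hinter : W₁ ∩ W₂ = {m} := by
      ext w
      constructor
      · rintro ⟨⟨-, h | h⟩, -, h'⟩
        · exact h
        · exact absurd h' h
      · rintro rfl
        exact ⟨⟨hm, Or.inl rfl⟩, hm, OnPath.finish⟩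
    have hunion : W₁ ∪ W₂ = W := by
      ext w
      constructor
      · rintro (h | h) <;> exact h.1
      · intro hw
        by_cases h : OnPath T u w m
        · exact Or.inr ⟨hw, h⟩
        · exact Or.inl ⟨hw, Or.inr h⟩
    have hsep : ∀ a ∈ W₁, ∀ b ∈ W₂, OnPath T a b m := by
      rintro a ⟨-, rfl | ha⟩ b ⟨-, hb⟩
      · exact OnPath.start
      · exact (hb.split a).resolve_left ha
    have := VertexSpine.glue hT h₁ h₂ hinter hmn hsep
      (fun i hi h => absurd (hmax _ (h₁.target_mem i hi).1) (not_le.2 (h ▸ hJ₁ i hi)))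
    rw [hunion] at this
    exact ⟨_, _, this, fun i hi => hi.elim (hJ₁ i) (hJ₂ i)⟩
  · have hlt : W \ {m} ⊂ W := Set.sdiff_singleton_ssubset.2 hm
    obtain ⟨J, X, h, hJ⟩ := ih _ (hss _ hlt) _ rfl
    have hne : ({u | u ∈ W \ {m} ∧ Visible T neg (W \ {m}) m u}).Nonempty := by
      -- the vertex closest to `m` is visible
      have hne : (W \ {m}).Nonempty := by
        by_contra hc
        rw [Set.not_nonempty_iff_eq_empty, Set.sdiff_eq_empty] at hc
        exact hW (Set.subsingleton_singleton.anti hc)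
      obtain ⟨y, hy, hmin⟩ :=
        Set.exists_min_image (W \ {m}) (fun y => T.dist m y) (Set.toFinite _) hne
      refine ⟨y, hy, fun v hv _ hvy hp => ?_⟩
      exact absurd (hmin v hv) (not_le.2 (hp.symm.dist_lt hT hvy))
    obtain ⟨a, ⟨haW, ha⟩, hamax⟩ := Set.exists_max_image _ id (Set.toFinite _) hne
    have hamax' : ∀ u ∈ W \ {m}, Visible T neg (W \ {m}) m u → u ≤ a :=
      fun u hu hu' => hamax u ⟨hu, hu'⟩
    obtain ⟨Y, hY⟩ := h.insert (m := m) (a := a) (fun h => h.2 rfl) haW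
      (fun hn c hc d hd hp => hsplit ⟨hn, c, hc.1, hc.2, d, hd.1, hd.2, hp⟩)
      (fun i hi hai _ => h.not_onPath_of_mem_cut hT hJ ha hamax' hi hai)
      (fun i hi hai hn hp => ha i.1 (h.source_mem i hi) hn
        (by rintro rfl; exact hai (h.left i hi)) hp.symm)
      (fun i hi hia => h.onPath_of_source_eq hT hJ haW ha hamax' hi hia)
    have hunion : W \ {m} ∪ {a, m} = W := by
      ext w
      simp only [Set.mem_union, Set.mem_sdiff, Set.mem_singleton_iff, Set.mem_insert_iff]
      constructor
      · rintro (h | rfl | rfl)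
        · exact h.1
        · exact haW.1
        · exact hm
      · intro hw
        by_cases hwm : w = m
        · exact Or.inr (Or.inr hwm)
        · exact Or.inl ⟨hw, hwm⟩
    rw [hunion] at hY
    refine ⟨_, _, hY, ?_⟩
    rintro i (hi | rfl)
    · exact hJ i hi
    · exact lt_of_le_of_ne (hmax a haW.1) haW.2

end VertexSpine

/-- Every linear order on `V` is compatible with a signed spine whose labels are singletons. -/
theorem SignedSpine.exists_increasing {V : Type*} [Finite V] [LinearOrder V] {T : SimpleGraph V}
    (hT : T.IsTree) (neg : Set V) :
    ∃ S : SignedSpine T neg, (∀ A ∈ S.nodes, A.Subsingleton) ∧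
      ∀ A B, S.Arc A B → ∀ u ∈ A, ∀ v ∈ B, u < v := by
  obtain ⟨J, X, h, hJ⟩ := VertexSpine.exists_increasing hT neg Set.univ
  have hne : (Set.univ : Set V).Nonempty := ⟨hT.1.nonempty.some, trivial⟩
  refine ⟨h.toSignedSpine hT Set.singleton_injective.injOn ?_ hne, ?_, ?_⟩
  · constructor
    · rintro ⟨v, -, hv⟩
      exact Set.singleton_ne_empty v hv
    · intro v
      refine ⟨{v}, ⟨⟨v, trivial, rfl⟩, rfl⟩, ?_⟩
      rintro _ ⟨⟨w, -, rfl⟩, rfl⟩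
      rfl
  · rintro _ ⟨v, -, rfl⟩
    exact Set.subsingleton_singleton
  · rintro _ _ ⟨i, hi, rfl, rfl⟩ _ rfl _ rfl
    exact hJ i hi

/-! ### Contraction of arcs -/

namespace SpineOn

variable {V N I : Type*} {T : SimpleGraph V} {neg : Set V} {W : Set N} {J : Set I}
  {s t : I → N} {X : I → Set N} {lab : N → Set V}

/-- The source side of an arc `i ≠ k` still lies in one component at the target of `i` after
contraction of the arc `k`: the vertices added to the label of this target do not separate it. -/
lemma in_same_of_contract (hT : T.IsTree) (h : SpineOn T neg W J s t X lab) {i k : I} (hi : i ∈ J)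
    (hk : k ∈ J) (hik : i ≠ k) {u v w : V} (hu : u ∈ labelUnion lab (X i))
    (hv : v ∈ labelUnion lab (X i))
    (hw : w ∈ lab (t i) ∨ (t i = s k ∨ t i = t k) ∧ (w ∈ lab (s k) ∨ w ∈ lab (t k)))
    (hn : w ∈ neg) : ¬ OnPath T u v w := by
  have hmain := h.in_same i hi u hu v hv
  rcases hw with hw | ⟨hik' | hik', hw | hw⟩
  · exact hmain w hw hn
  · exact hmain w (hik' ▸ hw) hn
  · have hsub := labelUnion_mono (lab := lab) (h.subset_of_target_eq_source hi hk hik')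
    exact h.in_same k hk u (hsub hu) v (hsub hv) w hw hn
  · intro hp
    obtain ⟨z, hz, hzn, hpz⟩ := h.in_diff i hi k hk hik hik' u hu w ⟨s k, h.left k hk, hw⟩
    exact hmain z hz hzn (hp.trans_left hT hpz)
  · exact hmain w (hik' ▸ hw) hn

/-- The source sides of two arcs with the same target after contraction of the arc `k` are separated
by a negative vertex of the merged label. -/
lemma in_diff_of_contract (h : SpineOn T neg W J s t X lab) {i j k : I} (hi : i ∈ J) (hj : j ∈ J)
    (hk : k ∈ J) (hik : i ≠ k) (hjk : j ≠ k) (hij : i ≠ j)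
    (ht : t i = t j ∨ (t i = s k ∨ t i = t k) ∧ (t j = s k ∨ t j = t k)) {u v : V}
    (hu : u ∈ labelUnion lab (X i)) (hv : v ∈ labelUnion lab (X j)) :
    ∃ w, (w ∈ lab (t i) ∨ (t i = s k ∨ t i = t k) ∧ (w ∈ lab (s k) ∨ w ∈ lab (t k))) ∧
      w ∈ neg ∧ OnPath T u v w := by
  by_cases htij : t i = t j
  · obtain ⟨w, hw, h'⟩ := h.in_diff i hi j hj hij htij u hu v hv
    exact ⟨w, Or.inl hw, h'⟩
  · rcases ht with ht | ⟨hti, htj⟩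
    · exact absurd ht htij
    refine (?_ : ∃ w ∈ lab (t k), w ∈ neg ∧ OnPath T u v w).imp fun w hw =>
      ⟨Or.inr ⟨hti, Or.inr hw.1⟩, hw.2⟩
    rcases hti with hti | hti
    · have htj : t j = t k := htj.resolve_left fun htj => htij (hti.trans htj.symm)
      have hsub := labelUnion_mono (lab := lab) (h.subset_of_target_eq_source hi hk hti)
      exact h.in_diff k hk j hj hjk.symm htj.symm u (hsub hu) v hv
    · have htj : t j = s k := htj.resolve_right fun htj => htij (hti.trans htj.symm)
      have hsub := labelUnion_mono (lab := lab) (h.subset_of_target_eq_source hj hk htj)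
      obtain ⟨w, hw, h'⟩ := h.in_diff i hi k hk hik hti u hu v (hsub hv)
      exact ⟨w, hti ▸ hw, h'⟩

end SpineOn

namespace LabeledDirectedTree

variable {V : Type*} {S : LabeledDirectedTree V}

/-- The label after contraction of the arc `p` of the node containing the node `C`. -/
def merge (S : LabeledDirectedTree V) (p : S.nodes × S.nodes) (C : S.nodes) : Set V :=
  mergeLabel p.1.1 p.2.1 C.1

variable {p : S.nodes × S.nodes}

lemma mem_merge {C : S.nodes} {u : V} :
    u ∈ S.merge p C ↔ u ∈ C.1 ∨ (C = p.1 ∨ C = p.2) ∧ (u ∈ p.1.1 ∨ u ∈ p.2.1) := by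
  simp only [merge, mergeLabel, ← Subtype.ext_iff]
  split_ifs with h
  · rw [Set.mem_union]
    constructor
    · intro hu; exact Or.inr ⟨h, hu⟩
    · rintro (hu | ⟨-, hu⟩)
      · rcases h with rfl | rfl
        · exact Or.inl hu
        · exact Or.inr hu
      · exact hu
  · simp [h]

lemma merge_eq_iff {C D : S.nodes} :
    S.merge p C = S.merge p D ↔ C = D ∨ (C = p.1 ∨ C = p.2) ∧ (D = p.1 ∨ D = p.2) := by
  constructor
  · intro h
    obtain ⟨u, hu⟩ := S.node_nonempty C
    have h1 : u ∈ S.merge p D := h ▸ mem_merge.2 (Or.inl hu)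
    rcases mem_merge.1 h1 with h1 | ⟨hD, h1⟩
    · exact Or.inl (node_eq hu h1)
    · exact Or.inr ⟨h1.imp (node_eq hu) (node_eq hu), hD⟩
  · rintro (rfl | ⟨hC, hD⟩)
    · rfl
    · simp only [merge, mergeLabel, ← Subtype.ext_iff, hC, hD, if_true]

lemma mem_merge_image_cut (hp : p ∈ S.arcs) {q : S.nodes × S.nodes} (hq : q ∈ S.arcs) (hqp : q ≠ p)
    {C : S.nodes} : S.merge p C ∈ S.merge p '' S.cut q ↔ C ∈ S.cut q := by
  refine ⟨?_, fun h => ⟨C, h, rfl⟩⟩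
  rintro ⟨D, hD, hDC⟩
  have hc := S.cutTree.cross q hq p hp hqp.symm
  rcases merge_eq_iff.1 hDC with rfl | ⟨rfl | rfl, rfl | rfl⟩
  · exact hD
  · exact hD
  · exact hc.1 hD
  · exact hc.2 hD
  · exact hD

lemma cutTree_contract (hp : p ∈ S.arcs) :
    CutTree (Set.range (S.merge p)) (S.arcs \ {p}) (fun q => S.merge p q.1)
      (fun q => S.merge p q.2) (fun q => S.merge p '' S.cut q) where
  source_mem q _ := ⟨q.1, rfl⟩
  target_mem q _ := ⟨q.2, rfl⟩
  sub q _ := Set.image_subset_range _ _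
  left q hq := ⟨q.1, S.cutTree.left q hq.1, rfl⟩
  right q hq := (mem_merge_image_cut hp hq.1 hq.2).not.2 (S.cutTree.right q hq.1)
  cross q hq q' hq' hne := by
    rw [mem_merge_image_cut hp hq.1 hq.2, mem_merge_image_cut hp hq.1 hq.2]
    exact S.cutTree.cross q hq.1 q' hq'.1 hne
  conn P hP := by
    rintro _ ⟨C, rfl⟩ _ ⟨D, rfl⟩ h
    refine S.cutTree.conn (fun C => P (S.merge p C)) ?_ C trivial D trivial h
    intro q hq
    by_cases hqp : q = p
    · rw [hqp, merge_eq_iff.2 (Or.inr ⟨Or.inl rfl, Or.inr rfl⟩)]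
    · exact hP q ⟨hq, hqp⟩

lemma labelUnion_merge_image_cut (hp : p ∈ S.arcs) {q : S.nodes × S.nodes} (hq : q ∈ S.arcs)
    (hqp : q ≠ p) :
    labelUnion id (S.merge p '' S.cut q) = labelUnion Subtype.val (S.cut q) := by
  have hc := S.cutTree.cross q hq p hp hqp.symm
  ext u
  constructor
  · rintro ⟨_, ⟨C, hC, rfl⟩, hu⟩
    rcases mem_merge.1 hu with hu | ⟨rfl | rfl, hu | hu⟩
    · exact ⟨C, hC, hu⟩
    · exact ⟨_, hC, hu⟩
    · exact ⟨_, hc.1 hC, hu⟩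
    · exact ⟨_, hc.2 hC, hu⟩
    · exact ⟨_, hC, hu⟩
  · rintro ⟨C, hC, hu⟩
    exact ⟨_, ⟨C, hC, rfl⟩, mem_merge.2 (Or.inl hu)⟩

lemma labelUnion_range_merge_sdiff (hp : p ∈ S.arcs) {q : S.nodes × S.nodes} (hq : q ∈ S.arcs)
    (hqp : q ≠ p) : labelUnion id (Set.range (S.merge p) \ S.merge p '' S.cut q) =
      labelUnion Subtype.val (Set.univ \ S.cut q) := by
  have hc := S.cutTree.cross q hq p hp hqp.symm
  ext u
  constructor
  · rintro ⟨_, ⟨⟨C, rfl⟩, hC⟩, hu⟩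
    rw [mem_merge_image_cut hp hq hqp] at hC
    rcases mem_merge.1 hu with hu | ⟨rfl | rfl, hu | hu⟩
    · exact ⟨C, ⟨trivial, hC⟩, hu⟩
    · exact ⟨_, ⟨trivial, hC⟩, hu⟩
    · exact ⟨_, ⟨trivial, hc.not.1 hC⟩, hu⟩
    · exact ⟨_, ⟨trivial, hc.not.2 hC⟩, hu⟩
    · exact ⟨_, ⟨trivial, hC⟩, hu⟩
  · rintro ⟨C, hC, hu⟩
    exact ⟨_, ⟨⟨C, rfl⟩, (mem_merge_image_cut hp hq hqp).not.2 hC.2⟩, mem_merge.2 (Or.inl hu)⟩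

lemma isPartition_range_merge : Setoid.IsPartition (id '' Set.range (S.merge p)) := by
  rw [Set.image_id]
  constructor
  · rintro ⟨C, hC⟩
    obtain ⟨u, hu⟩ := S.node_nonempty C
    exact Set.notMem_empty u (hC ▸ mem_merge.2 (Or.inl hu))
  · intro v
    obtain ⟨C, hC⟩ := S.exists_node v
    refine ⟨S.merge p C, ⟨⟨C, rfl⟩, mem_merge.2 (Or.inl hC)⟩, ?_⟩
    rintro _ ⟨⟨D, rfl⟩, hD⟩
    rw [merge_eq_iff]
    rcases mem_merge.1 hD with hD | ⟨h, hD⟩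
    · exact Or.inl (node_eq hD hC)
    · exact Or.inr ⟨h, hD.imp (fun h => node_eq hC h) (fun h => node_eq hC h)⟩

end LabeledDirectedTree

namespace SignedSpine

open LabeledDirectedTree

variable {V : Type*} {T : SimpleGraph V} {neg : Set V}

/-- Contracting the arc `p` preserves the spine conditions, the cuts of the other arcs being
unchanged as sets of vertices. -/
lemma spineOn_contract (hT : T.IsTree) (S : SignedSpine T neg) {p : S.nodes × S.nodes}
    (hp : p ∈ S.arcs) :
    SpineOn T neg (Set.range (S.merge p)) (S.arcs \ {p}) (fun q => S.merge p q.1)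
      (fun q => S.merge p q.2) (fun q => S.merge p '' S.cut q) id := by
  have h := S.spineOn hT
  refine ⟨cutTree_contract hp, ?_, ?_, ?_, ?_⟩
  · intro i hi u hu v hv w hw hn
    rw [labelUnion_merge_image_cut hp hi.1 hi.2] at hu hv
    exact h.in_same_of_contract hT hi.1 hp hi.2 hu hv (mem_merge.1 hw) hn
  · intro i hi j hj hne hij u hu v hv
    rw [labelUnion_merge_image_cut hp hi.1 hi.2] at hu
    rw [labelUnion_merge_image_cut hp hj.1 hj.2] at hv
    obtain ⟨w, hw, h'⟩ :=
      h.in_diff_of_contract hi.1 hj.1 hp hi.2 hj.2 hne (merge_eq_iff.1 hij) hu hv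
    exact ⟨w, mem_merge.2 hw, h'⟩
  · intro i hi u hu v hv w hw hn
    rw [labelUnion_range_merge_sdiff hp hi.1 hi.2] at hu hv
    refine h.flip.in_same_of_contract hT hi.1 hp hi.2 hu hv ?_ hn
    exact (mem_merge.1 hw).imp_right fun h => ⟨h.1.symm, h.2.symm⟩
  · intro i hi j hj hne hij u hu v hv
    rw [labelUnion_range_merge_sdiff hp hi.1 hi.2] at hu
    rw [labelUnion_range_merge_sdiff hp hj.1 hj.2] at hv
    obtain ⟨w, hw, h'⟩ := h.flip.in_diff_of_contract hi.1 hj.1 hp hi.2 hj.2 hne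
      ((merge_eq_iff.1 hij).imp_right fun h => ⟨h.1.symm, h.2.symm⟩) hu hv
    exact ⟨w, mem_merge.2 (hw.imp_right fun h => ⟨h.1.symm, h.2.symm⟩), h'⟩

/-- The signed spine obtained by contracting the arc `p`. -/
def contract (hT : T.IsTree) (S : SignedSpine T neg) {p : S.nodes × S.nodes} (hp : p ∈ S.arcs) :
    SignedSpine T neg :=
  (S.spineOn_contract hT hp).toSignedSpine hT Function.injective_id.injOn isPartition_range_merge
    ⟨_, p.1, rfl⟩

end SignedSpine

namespace LabeledDirectedTree

variable {V : Type*}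

/-- The function `x` is constant on the labels of `S` and weakly increases along its arcs: for `x`
in the hyperplane, `x` lies in the cone of `S`. -/
def IsCompatible (S : LabeledDirectedTree V) (x : V → ℝ) : Prop :=
  (∀ A ∈ S.nodes, ∀ u ∈ A, ∀ v ∈ A, x u = x v) ∧ ∀ A B, S.Arc A B → ∀ u ∈ A, ∀ v ∈ B, x u ≤ x v

/-- The function `y` takes equal values at the ends of all arcs of `S` where `x` does. -/
def TightOn (S : LabeledDirectedTree V) (x y : V → ℝ) : Prop :=
  ∀ A B, S.Arc A B → ∀ u ∈ A, ∀ v ∈ B, x u = x v → y u = y v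

variable {S : LabeledDirectedTree V} {x : V → ℝ}

lemma isCompatible_iff : S.IsCompatible x ↔ ∀ u v, S.Below u v → x u ≤ x v := by
  constructor
  · rintro h u v ⟨A, hA, B, hB, hu, hv, hAB⟩
    induction hAB generalizing v with
    | refl => exact (h.1 A hA u hu v hv).le
    | @tail C D _ hCD ih =>
      obtain ⟨hC, -⟩ := S.arc_mem C D hCD
      obtain ⟨w, hw⟩ := S.node_nonempty ⟨C, hC⟩
      exact (ih w hC hw).trans (h.2 C D hCD w hw v hv)
  · intro h
    constructor
    · intro A hA u hu v hv
      exact le_antisymm (h u v ⟨A, hA, A, hA, hu, hv, .refl⟩) (h v u ⟨A, hA, A, hA, hv, hu, .refl⟩)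
    · intro A B hAB u hu v hv
      obtain ⟨hA, hB⟩ := S.arc_mem A B hAB
      exact h u v ⟨A, hA, B, hB, hu, hv, .single hAB⟩

end LabeledDirectedTree

namespace SignedSpine

open LabeledDirectedTree

variable {V : Type*} {T : SimpleGraph V} {neg : Set V}

lemma mem_nodes_contract {hT : T.IsTree} {S : SignedSpine T neg} {p : S.nodes × S.nodes}
    {hp : p ∈ S.arcs} {A : Set V} :
    A ∈ (S.contract hT hp).nodes ↔ ∃ C, S.merge p C = A := by
  change A ∈ id '' Set.range (S.merge p) ↔ _
  rw [Set.image_id, Set.mem_range]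

lemma arc_contract {hT : T.IsTree} {S : SignedSpine T neg} {p : S.nodes × S.nodes}
    {hp : p ∈ S.arcs} {A B : Set V} :
    (S.contract hT hp).Arc A B ↔ ∃ q ∈ S.arcs, q ≠ p ∧ S.merge p q.1 = A ∧ S.merge p q.2 = B := by
  constructor
  · rintro ⟨q, hq, h⟩; exact ⟨q, hq.1, hq.2, h⟩
  · rintro ⟨q, hq, hqp, h⟩; exact ⟨q, ⟨hq, hqp⟩, h⟩

lemma isCompatible_contract {hT : T.IsTree} {S : SignedSpine T neg} {p : S.nodes × S.nodes}
    {hp : p ∈ S.arcs} {y : V → ℝ} : (S.contract hT hp).IsCompatible y ↔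
      S.IsCompatible y ∧ ∀ u ∈ p.1.1, ∀ v ∈ p.2.1, y u = y v := by
  have hm : ∀ {C : S.nodes} {u : V}, u ∈ C.1 → u ∈ S.merge p C := fun h => mem_merge.2 (Or.inl h)
  constructor
  · intro h
    have hpq : ∀ u ∈ p.1.1, ∀ v ∈ p.2.1, y u = y v := fun u hu v hv =>
      h.1 (S.merge p p.1) (mem_nodes_contract.2 ⟨_, rfl⟩) u (hm hu) v
        (mem_merge.2 (Or.inr ⟨Or.inl rfl, Or.inr hv⟩))
    refine ⟨⟨fun A hA u hu v hv => ?_, fun A B hAB u hu v hv => ?_⟩, hpq⟩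
    · exact h.1 (S.merge p ⟨A, hA⟩) (mem_nodes_contract.2 ⟨_, rfl⟩) u (hm hu) v (hm hv)
    · obtain ⟨hA, hB⟩ := S.arc_mem A B hAB
      by_cases hq : ((⟨A, hA⟩, ⟨B, hB⟩) : S.nodes × S.nodes) = p
      · subst hq
        exact (hpq u hu v hv).le
      · exact h.2 _ _ (arc_contract.2 ⟨(⟨A, hA⟩, ⟨B, hB⟩), hAB, hq, rfl, rfl⟩) u (hm hu) v (hm hv)
  · rintro ⟨h, hpq⟩
    -- every value of `y` on a merged label is attained on each of its parts
    have hrep : ∀ (C : S.nodes), ∀ u ∈ S.merge p C, ∀ v ∈ C.1, y u = y v := by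
      intro C u hu v hv
      rcases mem_merge.1 hu with hu | ⟨rfl | rfl, hu | hu⟩
      · exact h.1 C.1 C.2 u hu v hv
      · exact h.1 _ p.1.2 u hu v hv
      · exact (hpq v hv u hu).symm
      · exact hpq u hu v hv
      · exact h.1 _ p.2.2 u hu v hv
    constructor
    · intro A hA u hu v hv
      obtain ⟨C, rfl⟩ := mem_nodes_contract.1 hA
      obtain ⟨w, hw⟩ := S.node_nonempty C
      exact (hrep C u hu w hw).trans (hrep C v hv w hw).symm
    · intro A B hAB u hu v hv
      obtain ⟨q, hq, -, rfl, rfl⟩ := arc_contract.1 hAB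
      obtain ⟨a, ha⟩ := S.node_nonempty q.1
      obtain ⟨b, hb⟩ := S.node_nonempty q.2
      rw [hrep _ u hu a ha, hrep _ v hv b hb]
      exact h.2 _ _ hq a ha b hb

/-- Contracting the arcs along which a compatible function `x` is constant gives a signed spine
for which `x` is strict, and whose cone is the face of the cone of `S` cut out by the equalities
that hold for `x`. -/
theorem exists_isStrict [Finite V] (hT : T.IsTree) {x : V → ℝ} (S : SignedSpine T neg)
    (hx : S.IsCompatible x) : ∃ S' : SignedSpine T neg, S'.IsStrict x ∧
      ∀ y, S'.IsCompatible y ↔ S.IsCompatible y ∧ S.TightOn x y := by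
  induction hn : S.nodes.ncard using Nat.strong_induction_on generalizing S with
  | h n ih =>
  subst hn
  by_cases hstrict : S.IsStrict x
  · refine ⟨S, hstrict, fun y => ⟨fun hy => ⟨hy, ?_⟩, fun hy => hy.1⟩⟩
    intro A B hAB u hu v hv huv
    exact absurd huv (hstrict.2 A B hAB u hu v hv).ne
  obtain ⟨A, B, hAB, u₀, hu₀, v₀, hv₀, heq⟩ :
      ∃ A B, S.Arc A B ∧ ∃ u ∈ A, ∃ v ∈ B, x u = x v := by
    by_contra! hc
    exact hstrict ⟨hx.1, fun A B hAB u hu v hv =>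
      lt_of_le_of_ne (hx.2 A B hAB u hu v hv) (hc A B hAB u hu v hv)⟩
  obtain ⟨hA, hB⟩ := S.arc_mem A B hAB
  set p : S.nodes × S.nodes := (⟨A, hA⟩, ⟨B, hB⟩) with hpdef
  have hp : p ∈ S.arcs := hAB
  have hxp : ∀ u ∈ p.1.1, ∀ v ∈ p.2.1, x u = x v := fun u hu v hv =>
    (hx.1 A hA u hu u₀ hu₀).trans (heq.trans (hx.1 B hB v₀ hv₀ v hv))
  have hx₁ : (S.contract hT hp).IsCompatible x := isCompatible_contract.2 ⟨hx, hxp⟩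
  have hcard : (S.contract hT hp).nodes.ncard < S.nodes.ncard := by
    have hnodes : (S.contract hT hp).nodes = mergeLabel A B '' (S.nodes \ {B}) := by
      ext Z
      rw [mem_nodes_contract]
      constructor
      · rintro ⟨C, rfl⟩
        by_cases hCB : C.1 = B
        · refine ⟨A, ⟨hA, fun h => S.arc_asymm A B hAB ?_⟩, ?_⟩
          · rw [Set.mem_singleton_iff] at h; rw [h] at hAB ⊢; exact hAB
          · simp [merge, mergeLabel, hCB, hpdef]
        · exact ⟨C.1, ⟨C.2, hCB⟩, rfl⟩
      · rintro ⟨C, hC, rfl⟩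
        exact ⟨⟨C, hC.1⟩, rfl⟩
    rw [hnodes]
    exact (Set.ncard_image_le (Set.toFinite _)).trans_lt
      (Set.ncard_sdiff_singleton_lt_of_mem hB (Set.toFinite _))
  obtain ⟨S', hS', hS'y⟩ := ih _ hcard (S.contract hT hp) hx₁ rfl
  refine ⟨S', hS', fun y => ?_⟩
  rw [hS'y]
  have hm : ∀ {C : S.nodes} {u : V}, u ∈ C.1 → u ∈ S.merge p C := fun h => mem_merge.2 (Or.inl h)
  constructor
  · rintro ⟨hy, htight⟩
    obtain ⟨hy₁, hy₂⟩ := isCompatible_contract.1 hy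
    refine ⟨hy₁, fun C D hCD u hu v hv huv => ?_⟩
    obtain ⟨hC, hD⟩ := S.arc_mem C D hCD
    by_cases hq : ((⟨C, hC⟩, ⟨D, hD⟩) : S.nodes × S.nodes) = p
    · rw [← hq] at hy₂
      exact hy₂ u hu v hv
    · exact htight _ _ (arc_contract.2 ⟨(⟨C, hC⟩, ⟨D, hD⟩), hCD, hq, rfl, rfl⟩) u (hm hu) v (hm hv)
        huv
  · rintro ⟨hy, htight⟩
    have hy₁ : (S.contract hT hp).IsCompatible y :=
      isCompatible_contract.2 ⟨hy, fun u hu v hv => htight A B hAB u hu v hv (hxp u hu v hv)⟩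
    refine ⟨hy₁, fun C D hCD u hu v hv huv => ?_⟩
    obtain ⟨q, hq, -, rfl, rfl⟩ := arc_contract.1 hCD
    obtain ⟨a, ha⟩ := S.node_nonempty q.1
    obtain ⟨b, hb⟩ := S.node_nonempty q.2
    have h1 : ∀ z, (S.contract hT hp).IsCompatible z → z u = z a ∧ z v = z b := fun z hz =>
      ⟨hz.1 _ (mem_nodes_contract.2 ⟨_, rfl⟩) u hu a (hm ha),
        hz.1 _ (mem_nodes_contract.2 ⟨_, rfl⟩) v hv b (hm hb)⟩
    rw [(h1 x hx₁).1, (h1 x hx₁).2] at huv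
    rw [(h1 y hy₁).1, (h1 y hy₁).2]
    exact htight _ _ hq a ha b hb huv

/-- Every function on `V` is compatible with some signed spine. -/
theorem exists_isCompatible [Finite V] (hT : T.IsTree) (neg : Set V) (x : V → ℝ) :
    ∃ S : SignedSpine T neg, S.IsCompatible x := by
  obtain ⟨n, ⟨e⟩⟩ := Finite.exists_equiv_fin V
  -- refine the preorder given by `x` to a linear order
  let _ : LinearOrder V := LinearOrder.lift' (fun v => toLex (x v, e v)) (by
    intro u v h
    exact e.injective (congrArg Prod.snd (toLex.injective h)))
  obtain ⟨S, hS, hS'⟩ := SignedSpine.exists_increasing hT neg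
  refine ⟨S, fun A hA u hu v hv => by rw [hS A hA hu hv], fun A B hAB u hu v hv => ?_⟩
  have h : toLex (x u, e u) < toLex (x v, e v) := hS' A B hAB u hu v hv
  rw [Prod.Lex.toLex_lt_toLex] at h
  rcases h with h | h
  · exact h.le
  · exact h.1.le

end SignedSpine

/-! ### The cones of the spine fan -/

open LabeledDirectedTree

lemma centerH_add_mem_hyperplaneH {V : Type*} [Fintype V] {y : V → ℝ} :
    centerH V + y ∈ hyperplaneH V ↔ ∑ v, y v = 0 := by
  have h : (((Fintype.card V + 1).choose 2 : ℕ) : ℝ) =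
      Fintype.card V * ((Fintype.card V + 1) / 2) := by
    rw [Nat.cast_choose_two]; push_cast; ring
  simp only [hyperplaneH, Set.mem_ofPred_eq, h, centerH, Pi.add_apply, Finset.sum_add_distrib,
    Finset.sum_const, Finset.card_univ, nsmul_eq_mul]
  constructor <;> intro h <;> linarith

namespace LabeledDirectedTree

variable {V : Type*} {S : LabeledDirectedTree V} {x y : V → ℝ}

lemma IsCompatible.add (hx : S.IsCompatible x) (hy : S.IsCompatible y) :
    S.IsCompatible (x + y) :=
  ⟨fun A hA u hu v hv => congrArg₂ (· + ·) (hx.1 A hA u hu v hv) (hy.1 A hA u hu v hv),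
    fun A B hAB u hu v hv => add_le_add (hx.2 A B hAB u hu v hv) (hy.2 A B hAB u hu v hv)⟩

variable [Fintype V]

/-- The pointed cone of vectors with coordinate sum zero that are compatible with `S`. -/
def linearCone (S : LabeledDirectedTree V) : PointedCone ℝ (V → ℝ) where
  carrier := {y | ∑ v, y v = 0 ∧ S.IsCompatible y}
  add_mem' {x y} hx hy := by
    refine ⟨?_, hx.2.add hy.2⟩
    simp only [Pi.add_apply, Finset.sum_add_distrib]
    rw [hx.1, hy.1, add_zero]
  zero_mem' := ⟨by simp, fun _ _ _ _ _ _ => rfl, fun _ _ _ _ _ _ _ => le_rfl⟩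
  smul_mem' c y hy := by
    refine ⟨?_, fun A hA u hu v hv => ?_, fun A B hAB u hu v hv => ?_⟩
    · have : ∑ v, (c • y) v = c • ∑ v, y v := by rw [Finset.smul_sum]; rfl
      rw [this, hy.1, smul_zero]
    · exact congrArg (c • ·) (hy.2.1 A hA u hu v hv)
    · exact smul_le_smul_of_nonneg_left (hy.2.2 A B hAB u hu v hv) c.2

lemma mem_linearCone : y ∈ S.linearCone ↔ ∑ v, y v = 0 ∧ S.IsCompatible y := Iff.rfl

open Classical in
/-- The generator of the cone of `S` belonging to the arc `p`: the vector with coordinate sum zero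
that is constant on both sides of the cut of `p` and increases by `|V|` across this cut. -/
def generator (S : LabeledDirectedTree V) (p : S.nodes × S.nodes) (v : V) : ℝ :=
  Fintype.card V * (if v ∈ labelUnion Subtype.val (S.cut p) then 0 else 1) -
    ∑ w, if w ∈ labelUnion Subtype.val (S.cut p) then 0 else 1

lemma sum_generator (p : S.nodes × S.nodes) : ∑ v, S.generator p v = 0 := by
  simp only [generator, Finset.sum_sub_distrib, Finset.sum_const, Finset.card_univ, nsmul_eq_mul,
    ← Finset.mul_sum, sub_self]

lemma generator_eq {p : S.nodes × S.nodes} {A B : S.nodes} (h : A ∈ S.cut p ↔ B ∈ S.cut p)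
    {u v : V} (hu : u ∈ A.1) (hv : v ∈ B.1) : S.generator p u = S.generator p v := by
  have hiff : u ∈ labelUnion Subtype.val (S.cut p) ↔ v ∈ labelUnion Subtype.val (S.cut p) := by
    rw [mem_labelUnion_iff hu, mem_labelUnion_iff hv, h]
  by_cases hv' : v ∈ labelUnion Subtype.val (S.cut p) <;> simp [generator, hiff, hv']

lemma generator_target {p : S.nodes × S.nodes} (hp : p ∈ S.arcs) {u v : V} (hu : u ∈ p.1.1)
    (hv : v ∈ p.2.1) : S.generator p v = S.generator p u + Fintype.card V := by
  simp only [generator, mem_labelUnion_iff hu, mem_labelUnion_iff hv, S.cutTree.left p hp,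
    S.cutTree.right p hp, if_true, if_false]
  ring

lemma generator_mem_linearCone {p : S.nodes × S.nodes} (hp : p ∈ S.arcs) :
    S.generator p ∈ S.linearCone := by
  refine mem_linearCone.2 ⟨sum_generator p, fun A hA u hu v hv => ?_, fun A B hAB u hu v hv => ?_⟩
  · exact generator_eq (A := ⟨A, hA⟩) Iff.rfl hu hv
  · obtain ⟨hA, hB⟩ := S.arc_mem A B hAB
    by_cases hq : ((⟨A, hA⟩, ⟨B, hB⟩) : S.nodes × S.nodes) = p
    · subst hq
      rw [generator_target hp hu hv]
      simp
    · exact (generator_eq (S.cutTree.cross p hp _ hAB hq) hu hv).le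

/-- Across the arc `q`, a combination of generators changes by the coefficient of `q` times
`|V|`. -/
lemma sum_smul_generator {c : S.nodes × S.nodes → ℝ} {s : Finset (S.nodes × S.nodes)}
    (hs : ∀ p ∈ s, p ∈ S.arcs) {q : S.nodes × S.nodes} (hq : q ∈ S.arcs) {u v : V} (hu : u ∈ q.1.1)
    (hv : v ∈ q.2.1) (hqs : q ∈ s) :
    ∑ p ∈ s, c p * S.generator p v = ∑ p ∈ s, c p * S.generator p u + c q * Fintype.card V := by
  classical
  rw [← Finset.add_sum_erase s _ hqs, ← Finset.add_sum_erase s (fun p => c p * S.generator p u) hqs,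
    generator_target hq hu hv]
  have : ∑ p ∈ s.erase q, c p * S.generator p v = ∑ p ∈ s.erase q, c p * S.generator p u := by
    refine Finset.sum_congr rfl fun p hp => ?_
    rw [Finset.mem_erase] at hp
    rw [generator_eq (S.cutTree.cross p (hs p hp.2) q hq hp.1.symm) hu hv]
  rw [this]
  ring

/-- The cone of a labeled directed tree is simplicial. -/
lemma isSimplicial_linearCone [Nonempty V] : S.linearCone.IsSimplicial := by
  classical
  have hfin : Finite S.nodes := inferInstance
  have hcard : (Fintype.card V : ℝ) ≠ 0 := by exact_mod_cast Fintype.card_ne_zero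
  have hpick : ∀ A : S.nodes, ∃ u, u ∈ A.1 := fun A => S.node_nonempty A
  choose rep hrep using hpick
  set s : Finset (S.nodes × S.nodes) := (Set.toFinite S.arcs).toFinset with hs
  have hmem : ∀ p, p ∈ s ↔ p ∈ S.arcs := fun p => Set.Finite.mem_toFinset _
  refine ⟨Set.range (fun p : S.arcs => S.generator p.1), Set.finite_range _, ?_, ?_⟩
  · refine LinearIndependent.linearIndepOn_id ?_
    rw [linearIndependent_iff']
    intro s' c hc q hq
    have hsum : ∀ v, ∑ p ∈ s'.map (Function.Embedding.subtype _),
        (if h : p ∈ S.arcs then c ⟨p, h⟩ else 0) * S.generator p v = 0 := by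
      intro v
      rw [Finset.sum_map]
      have := congrFun hc v
      simpa [Finset.sum_apply] using this
    have := sum_smul_generator (c := fun p => if h : p ∈ S.arcs then c ⟨p, h⟩ else 0)
      (s := s'.map (Function.Embedding.subtype _)) (by
        intro p hp
        obtain ⟨p', -, rfl⟩ := Finset.mem_map.1 hp
        exact p'.2) q.2 (hrep q.1.1) (hrep q.1.2) (Finset.mem_map.2 ⟨q, hq, rfl⟩)
    rw [hsum, hsum, zero_add] at this
    simpa [hcard] using this.symm
  · refine le_antisymm ?_ ?_
    · refine Submodule.span_le.2 ?_
      rintro _ ⟨p, rfl⟩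
      exact generator_mem_linearCone p.2
    · intro y hy
      obtain ⟨hy0, hyc⟩ := mem_linearCone.1 hy
      set c : S.nodes × S.nodes → ℝ := fun p => (y (rep p.2) - y (rep p.1)) / Fintype.card V with hc
      have hyeq : y = ∑ p ∈ s, c p • S.generator p := by
        -- the difference `z` has coordinate sum zero and is constant
        set z : V → ℝ := y - ∑ p ∈ s, c p • S.generator p with hz
        have hzv : ∀ v, z v = y v - ∑ p ∈ s, c p * S.generator p v := by
          intro v
          simp [hz, Finset.sum_apply]
        have hznode : ∀ A : S.nodes, ∀ u ∈ A.1, ∀ v ∈ A.1, z u = z v := by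
          intro A u hu v hv
          rw [hzv, hzv, hyc.1 A.1 A.2 u hu v hv]
          congr 1
          exact Finset.sum_congr rfl fun p _ => by rw [generator_eq (A := A) Iff.rfl hu hv]
        have hzarc : ∀ q ∈ S.arcs, z (rep q.1) = z (rep q.2) := by
          intro q hq
          rw [hzv, hzv, sum_smul_generator (fun p hp => (hmem p).1 hp) hq (hrep q.1) (hrep q.2)
            ((hmem q).2 hq)]
          simp only [hc]
          field_simp
          ring
        have hzconst : ∀ u v, z u = z v := by
          intro u v
          obtain ⟨A, hA⟩ := S.exists_node u
          obtain ⟨B, hB⟩ := S.exists_node v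
          have := S.cutTree.conn (fun C => z (rep C) = z u) (fun q hq => by
            rw [hzarc q hq]) A trivial B trivial (hznode A _ (hrep A) _ hA)
          rw [← this, hznode B _ (hrep B) _ hB]
        have hzsum : ∑ v, z v = 0 := by
          simp only [hzv, Finset.sum_sub_distrib]
          rw [hy0, Finset.sum_comm]
          simp [← Finset.mul_sum, sum_generator]
        have hz0 : z = 0 := by
          funext v
          have : ∑ w, z w = Fintype.card V * z v := by
            rw [Finset.sum_congr rfl fun w _ => hzconst w v]
            simp
          rw [this] at hzsum
          exact (mul_eq_zero.1 hzsum).resolve_left hcard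
        exact sub_eq_zero.1 hz0
      rw [hyeq]
      refine Submodule.sum_mem _ fun p hp => ?_
      have hpa := (hmem p).1 hp
      refine PointedCone.smul_mem _ ?_ (Submodule.subset_span ⟨⟨p, hpa⟩, rfl⟩)
      have := hyc.2 _ _ hpa _ (hrep p.1) _ (hrep p.2)
      exact div_nonneg (sub_nonneg.2 this) (Nat.cast_nonneg _)

end LabeledDirectedTree

namespace SignedSpine

open LabeledDirectedTree

variable {V : Type*} [Fintype V] {T : SimpleGraph V} {neg : Set V}

lemma mem_cone_iff {S : SignedSpine T neg} {x : V → ℝ} :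
    x ∈ S.cone ↔ x ∈ hyperplaneH V ∧ S.IsCompatible x := by
  rw [isCompatible_iff]; rfl

lemma cone_eq_coneAt (S : SignedSpine T neg) : S.cone = coneAt (centerH V) S.linearCone := by
  ext x
  have h : S.IsCompatible (x - centerH V) ↔ S.IsCompatible x := by
    simp [IsCompatible, centerH]
  rw [mem_cone_iff, coneAt, Set.mem_ofPred_eq, mem_linearCone, h,
    ← centerH_add_mem_hyperplaneH, add_sub_cancel]

lemma linearCone_eq {S : SignedSpine T neg} {K : PointedCone ℝ (V → ℝ)}
    (h : coneAt (centerH V) K = S.cone) : K = S.linearCone := by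
  rw [cone_eq_coneAt] at h
  ext y
  have := Set.ext_iff.1 h (centerH V + y)
  simpa [coneAt] using this

/-- Every face of the cone of a signed spine is the cone of a signed spine, namely of the one that
is strict for a vector of the face satisfying as few equalities as possible. -/
lemma exists_linearCone_eq_of_isFaceOf (hT : T.IsTree) (S : SignedSpine T neg)
    {F : PointedCone ℝ (V → ℝ)} (hF : F.IsFaceOf S.linearCone) :
    ∃ S' : SignedSpine T neg, F = S'.linearCone := by
  set pairs : (V → ℝ) → Set (V × V) := fun y =>
    {p | (∃ A B, S.Arc A B ∧ p.1 ∈ A ∧ p.2 ∈ B) ∧ y p.1 ≠ y p.2} with hpairs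
  obtain ⟨n, ⟨⟨y₀, hy₀F, hy₀n⟩, hn⟩⟩ : ∃ n, (∃ y ∈ F, (pairs y).ncard = n) ∧
      ∀ y ∈ F, (pairs y).ncard ≤ n := by
    obtain ⟨_, ⟨y, hy, rfl⟩, hmax⟩ := Set.exists_max_image
      ((fun y => (pairs y).ncard) '' (F : Set (V → ℝ))) id
      ((Set.finite_Iic (Nat.card (V × V))).subset (by
        rintro _ ⟨y, -, rfl⟩
        exact Set.ncard_le_card _))
      ⟨_, 0, F.zero_mem, rfl⟩
    exact ⟨_, ⟨y, hy, rfl⟩, fun y' hy' => hmax _ ⟨y', hy', rfl⟩⟩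
  have hy₀ := (mem_linearCone.1 (hF.le hy₀F)).2
  obtain ⟨S', -, hS'⟩ := exists_isStrict hT S hy₀
  refine ⟨S', le_antisymm (fun y hy => ?_) (fun y hy => ?_)⟩
  · obtain ⟨hy0, hyc⟩ := mem_linearCone.1 (hF.le hy)
    refine mem_linearCone.2 ⟨hy0, (hS' y).2 ⟨hyc, fun A B hAB u hu v hv huv => ?_⟩⟩
    by_contra hne
    have hsub : pairs y₀ ⊆ pairs (y₀ + y) := by
      rintro p ⟨⟨C, D, hCD, hC, hD⟩, hp⟩
      have h1 := hy₀.2 C D hCD _ hC _ hD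
      have h2 := hyc.2 C D hCD _ hC _ hD
      refine ⟨⟨C, D, hCD, hC, hD⟩, (add_lt_add_of_lt_of_le (lt_of_le_of_ne h1 hp) h2).ne⟩
    have hlt : (pairs y₀).ncard < (pairs (y₀ + y)).ncard := by
      refine Set.ncard_lt_ncard ⟨hsub, fun h => ?_⟩ (Set.toFinite _)
      have h1 : (u, v) ∈ pairs (y₀ + y) := by
        refine ⟨⟨A, B, hAB, hu, hv⟩, ?_⟩
        simpa [huv] using hne
      exact (h h1).2 huv
    have := hn _ (F.add_mem hy₀F hy)
    omega
  · obtain ⟨hy0, hyc'⟩ := mem_linearCone.1 hy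
    obtain ⟨hyc, htight⟩ := (hS' y).1 hyc'
    -- a large multiple of `y₀` exceeds `y` within the cone
    have hev : ∀ᶠ c : ℝ in Filter.atTop, ∀ p : V × V, y₀ p.1 < y₀ p.2 →
        y p.2 - y p.1 ≤ c * (y₀ p.2 - y₀ p.1) := by
      rw [Filter.eventually_all]
      intro p
      by_cases hp : y₀ p.1 < y₀ p.2
      · filter_upwards [(Filter.tendsto_id.atTop_mul_const (sub_pos.2 hp)).eventually_ge_atTop
          (y p.2 - y p.1)] with c hc _
        exact hc
      · exact Filter.Eventually.of_forall fun c h => absurd h hp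
    obtain ⟨c, hc, hc0⟩ := (hev.and (Filter.eventually_ge_atTop 0)).exists
    have hz : c • y₀ - y ∈ S.linearCone := by
      refine mem_linearCone.2 ⟨?_, fun A hA u hu v hv => ?_, fun A B hAB u hu v hv => ?_⟩
      · simp [Finset.sum_sub_distrib, ← Finset.mul_sum, hy0, (mem_linearCone.1 (hF.le hy₀F)).1]
      · simp [hy₀.1 A hA u hu v hv, hyc.1 A hA u hu v hv]
      · simp only [Pi.sub_apply, Pi.smul_apply, smul_eq_mul]
        rcases (hy₀.2 A B hAB u hu v hv).lt_or_eq with h | h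
        · have := hc (u, v) h
          simp only at this
          linarith
        · rw [h, htight A B hAB u hu v hv h]
    refine hF.mem_of_smul_add_mem (a := 1) (mem_linearCone.2 ⟨hy0, hyc⟩) hz one_pos ?_
    rw [one_smul, add_sub_cancel]
    exact F.smul_mem hc0 hy₀F

/-- A vector in the common part of two cones is strict for the same signed spine, obtained from
either spine by contraction, so that the common part is a face. -/
lemma isFaceOf_inf_linearCone (hT : T.IsTree) (S S' : SignedSpine T neg) :
    (S.linearCone ⊓ S'.linearCone).IsFaceOf S.linearCone := by
  refine ⟨inf_le_left, fun {x z a} hx hz ha hxz => ⟨hx, ?_⟩⟩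
  obtain ⟨hx0, hxc⟩ := mem_linearCone.1 hx
  obtain ⟨-, hzc⟩ := mem_linearCone.1 hz
  obtain ⟨R, hR, hRy⟩ := exists_isStrict hT S (mem_linearCone.1 hxz.1).2
  obtain ⟨R', hR', hRy'⟩ := exists_isStrict hT S' (mem_linearCone.1 hxz.2).2
  obtain rfl := eq_of_isStrict hT hR hR'
  refine mem_linearCone.2 ⟨hx0, ((hRy' x).1 ((hRy x).2 ⟨hxc, fun A B hAB u hu v hv h => ?_⟩)).1⟩
  have h1 := hxc.2 A B hAB u hu v hv
  have h2 := hzc.2 A B hAB u hu v hv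
  simp only [Pi.add_apply, Pi.smul_apply, smul_eq_mul] at h
  refine le_antisymm h1 (le_of_mul_le_mul_left ?_ ha)
  linarith

theorem isCompleteSimplicialFan (hT : T.IsTree) :
    IsCompleteSimplicialFan (hyperplaneH V) (centerH V) (spineFan T neg) where
  finite := by
    refine (Set.finite_range (preposetCone : (V → V → Prop) → Set (V → ℝ))).subset ?_
    rintro _ ⟨S, rfl⟩
    exact ⟨_, rfl⟩
  simplicial := by
    have := hT.1.nonempty
    rintro _ ⟨S, rfl⟩
    exact ⟨S.linearCone, isSimplicial_linearCone, S.cone_eq_coneAt⟩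
  face_mem := by
    rintro K F ⟨S, hS⟩ hF
    obtain rfl := linearCone_eq hS.symm
    obtain ⟨S', rfl⟩ := S.exists_linearCone_eq_of_isFaceOf hT hF
    exact ⟨S', S'.cone_eq_coneAt⟩
  inter_face := by
    rintro K K' ⟨S, hS⟩ ⟨S', hS'⟩
    obtain rfl := linearCone_eq hS.symm
    obtain rfl := linearCone_eq hS'.symm
    exact ⟨isFaceOf_inf_linearCone hT S S', inf_comm S.linearCone S'.linearCone ▸
      isFaceOf_inf_linearCone hT S' S⟩
  sUnion_eq := by
    ext x
    constructor
    · rintro ⟨_, ⟨S, rfl⟩, hx⟩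
      exact hx.1
    · intro hx
      obtain ⟨S, hS⟩ := exists_isCompatible hT neg x
      exact ⟨_, ⟨S, rfl⟩, mem_cone_iff.2 ⟨hx, hS⟩⟩

end SignedSpine

/-! ### The braid fan and linear orders -/

/-- A total preorder on a finite set is the pullback of the order of the real numbers under the
function counting the elements below. -/
lemma exists_rank {V : Type*} [Finite V] {r : V → V → Prop} (hrefl : ∀ u, r u u)
    (htrans : ∀ u v w, r u v → r v w → r u w) (htotal : ∀ u v, r u v ∨ r v u) :
    ∃ x : V → ℝ, ∀ u v, x u ≤ x v ↔ r u v := by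
  refine ⟨fun u => ({w | r w u}.ncard : ℝ), fun u v => ?_⟩
  rw [Nat.cast_le]
  constructor
  · intro h
    by_contra hr
    have hvu := (htotal u v).resolve_left hr
    refine absurd h (not_le.2 (Set.ncard_lt_ncard ⟨fun w hw => htrans w v u hw hvu, fun h => ?_⟩
      (Set.toFinite _)))
    exact hr (h (hrefl u))
  · intro h
    exact Set.ncard_le_ncard (fun w hw => htrans w u v hw h) (Set.toFinite _)

namespace SignedSpine

open LabeledDirectedTree

/-- A signed spine whose labels are singletons is maximal: a contraction produces a label with at
least two elements. -/
lemma isMax_of_subsingleton {V : Type*} {T : SimpleGraph V} {neg : Set V}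
    {S : SignedSpine T neg} (hS : ∀ A ∈ S.nodes, A.Subsingleton) :
    IsMax S := by
  intro S' hS'
  rcases Relation.ReflTransGen.cases_tail (show Relation.ReflTransGen
    (fun R R' : SignedSpine T neg => R.toLabeledDirectedTree.IsArcContraction
      R'.toLabeledDirectedTree) S' S from hS') with rfl | ⟨R, -, A, B, hAB, hnodes, -⟩
  · exact le_rfl
  · obtain ⟨hA, hB⟩ := R.arc_mem A B hAB
    obtain ⟨u, hu⟩ := R.node_nonempty ⟨A, hA⟩
    obtain ⟨v, hv⟩ := R.node_nonempty ⟨B, hB⟩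
    have hmem : A ∪ B ∈ S.nodes := by
      rw [hnodes]
      exact ⟨A, hA, by simp [mergeLabel]⟩
    have huv : u = v := hS _ hmem (Or.inl hu) (Or.inr hv)
    subst huv
    have := congrArg Subtype.val (R.node_eq (A := ⟨A, hA⟩) (B := ⟨B, hB⟩) hu hv)
    simp only at this
    subst this
    exact absurd hAB (R.arc_asymm A A hAB)

variable {V : Type*} [Fintype V] {T : SimpleGraph V} {neg : Set V}

theorem fanCoarsens (hT : T.IsTree) : FanCoarsens (spineFan T neg) (braidFan V) := by
  constructor
  · rintro _ ⟨r, hr, htotal, rfl⟩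
    obtain ⟨x, hx⟩ := exists_rank hr.refl hr.trans htotal
    obtain ⟨S, hS⟩ := exists_isCompatible hT neg x
    refine ⟨_, ⟨S, rfl⟩, fun y hy => ⟨hy.1, fun u v huv => hy.2 u v ?_⟩⟩
    rw [← hx]
    exact isCompatible_iff.1 hS u v huv
  · rintro _ ⟨S, rfl⟩
    refine ⟨{D ∈ braidFan V | D ⊆ S.cone}, fun D hD => hD.1, ?_⟩
    refine Set.Subset.antisymm (fun x hx => ?_) (Set.sUnion_subset fun D hD => hD.2)
    refine ⟨preposetCone fun u v => x u ≤ x v, ⟨⟨_, ?_, fun u v => le_total _ _, rfl⟩, ?_⟩,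
      hx.1, fun u v h => h⟩
    · exact { refl := fun u => le_rfl, trans := fun u v w => le_trans }
    · exact fun y hy => ⟨hy.1, fun u v huv => hy.2 u v (hx.2 u v huv)⟩

theorem existsUnique_isMax (hT : T.IsTree) {r : V → V → Prop} (hr : IsLinearOrder V r) :
    ∃! S : SignedSpine T neg, IsMax S ∧ ∀ u v, S.Below u v → r u v := by
  obtain ⟨x, hx⟩ := exists_rank hr.refl hr.trans hr.total
  have hinj : Function.Injective x := fun u v huv =>
    hr.antisymm u v ((hx u v).1 huv.le) ((hx v u).1 huv.ge)
  have hstrict : ∀ S : SignedSpine T neg, (∀ u v, S.Below u v → r u v) → S.IsStrict x := by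
    intro S hS
    have hc : S.IsCompatible x := isCompatible_iff.2 fun u v huv => (hx u v).2 (hS u v huv)
    refine ⟨hc.1, fun A B hAB u hu v hv => lt_of_le_of_ne (hc.2 A B hAB u hu v hv) fun h => ?_⟩
    obtain ⟨hA, hB⟩ := S.arc_mem A B hAB
    obtain rfl := hinj h
    exact arc_ne (A := ⟨A, hA⟩) (B := ⟨B, hB⟩) hAB (node_eq hu hv)
  let _ : LinearOrder V := LinearOrder.lift' x hinj
  obtain ⟨S, hS, hS'⟩ := SignedSpine.exists_increasing hT neg
  have hSr : ∀ u v, S.Below u v → r u v := by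
    intro u v huv
    rw [← hx]
    refine isCompatible_iff.1 ⟨fun A hA u hu v hv => by rw [hS A hA hu hv], ?_⟩ u v huv
    exact fun A B hAB u hu v hv => (show x u < x v from hS' A B hAB u hu v hv).le
  exact ⟨S, ⟨isMax_of_subsingleton hS, hSr⟩, fun S' hS' =>
    eq_of_isStrict hT (hstrict S' hS'.2) (hstrict S hSr)⟩

end SignedSpine

end

theorem theorem45 {V : Type*} [Fintype V] (T : SimpleGraph V) (hT : T.IsTree) (neg : Set V) :
    IsCompleteSimplicialFan (hyperplaneH V) (centerH V) (spineFan T neg) ∧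
    FanCoarsens (spineFan T neg) (braidFan V) ∧
    (∀ r : V → V → Prop, IsLinearOrder V r →
      ∃! S : SignedSpine T neg, IsMax S ∧
        ∀ u v, S.toLabeledDirectedTree.Below u v → r u v) :=
  ⟨SignedSpine.isCompleteSimplicialFan hT, SignedSpine.fanCoarsens hT,
    fun _ hr => SignedSpine.existsUnique_isMax hT hr⟩
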